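/- **Setting.** A two-layered cake consists of two copies (layers) of $[0,1]$. A piece is a finite union of disjoint closed subintervals of $[0,1]$; a layered piece $\mathcal L=(L_1,L_2)$ consists of one (possibly empty) piece of each layer. It is *contiguous* if each $L_\ell$ is an interval, and *non-overlapping* if $L_1\cap L_2$ is finite. A multi-division into three layered pieces $\mathcal A=(\mathcal A_1,\mathcal A_2,\mathcal A_3)$ covers both layers, and its layered pieces have pairwise disjoint interiors in each layer; it is contiguous (resp. feasible) if all three layered pieces are contiguous (resp. non-overlapping). It uses only one short knife and one long knife if there are $x,y\in[0,1]$ and one layer $\ell_0$ such that, apart from the ends $0,1$ of the cake, the boundary points of the pieces are all at $x$ (in any layer) or at $y$ (in layer $\ell_0$). Each agent $i$ has a valuation function $v_i$ assigning a real number to every layered piece; it is *monotone* if $v_i(\mathcal L)\le v_i(\mathcal L')$ whenever $L_\ell\subseteq L'_\ell$ for $\ell=1,2$, and *Lipschitz with constant $K$* if $|v_i(\mathcal L)-v_i(\mathcal L')|\le K\,\mu(\mathcal L\triangle\mathcal L')$ for all layered pieces, where $\mu(\mathcal L\triangle\mathcal L')$ is the sum over the layers of the Lebesgue measures of $L_\ell\triangle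 L'_\ell$. Algorithms are programs working on real registers with unit-cost arithmetic operations and comparisons, which obtain the value $v_i(\mathcal L)$ of a contiguous layered piece, given by the end points of its intervals, in one step. **Theorem.** There are a single algorithm and a constant $C$ such that the following holds for every $n\ge 3$, all $n$ agents whose valuation functions $v_1,\dots,v_n$ are monotone and Lipschitz with constant $K$, and every $\varepsilon>0$. Given $n$, $K$, $\varepsilon$ and access to $v_1,\dots,v_{n-1}$ (but not to the valuation $v_n$ of the birthday agent $n$), the algorithm stops after at most $C\,n\log^2\!\left(2+\frac K\varepsilon\right)$ steps (that is, in time $O(n\log^2\frac K\varepsilon)$) and outputs the end points of the intervals of a feasible and contiguous multi-division $\mathcal A=(\mathcal A_1,\mathcal A_2,\mathcal A_3)$ of the two-layered cake, which uses only one short knife and one long knife, such that for every $j^*\in\{1,2,3\}$ there is an assignment $\pi_{j^*}\colon\{1,\dots,n\}\to\{1,2,3\}$ with - $\pi_{j^*}(n)=j^*$, - $v_i(\mathcal A_{\pi_{j^*}(i)})+\varepsilon\ge\max_{j\in\{1,2,3\}}v_i(\mathcal A_j)$ for every $i\in\{1,\dots,n-1\}$, and - $|\pi_{j^*}^{-1}(j)|\in\{\lfloor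 n/3\rfloor,\lceil n/3\rceil\}$ for every $j\in\{1,2,3\}$. -/

import Mathlib

namespace LayeredCake

/-! ### Layered cakes and multi-divisions -/

/-- A piece of cake: a union of finitely many disjoint closed subintervals of `[0,1]`
(possibly no interval at all; intervals may be reduced to a point). -/
def IsPiece (S : Set ℝ) : Prop :=
  ∃ F : Finset (ℝ × ℝ),
    (∀ p ∈ F, 0 ≤ p.1 ∧ p.1 ≤ p.2 ∧ p.2 ≤ 1) ∧
    (F : Set (ℝ × ℝ)).PairwiseDisjoint (fun p => Set.Icc p.1 p.2) ∧
    S = ⋃ p ∈ F, Set.Icc p.1 p.2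

/-- A layered piece of the `m`-layered cake: one piece of each layer. -/
structure LayeredPiece (m : ℕ) where
  layer : Fin m → Set ℝ
  isPiece : ∀ l, IsPiece (layer l)

/-- A layered piece is contiguous if its part in each layer is a closed interval
(`Set.Icc a b` is the empty interval when `b < a`). -/
def LayeredPiece.Contiguous {m : ℕ} (L : LayeredPiece m) : Prop :=
  ∀ l, ∃ a b : ℝ, L.layer l = Set.Icc a b

/-- A layered piece is non-overlapping if its parts in distinct layers share only
finitely many points. -/
def LayeredPiece.NonOverlapping {m : ℕ} (L : LayeredPiece m) : Prop :=
  ∀ l l', l ≠ l' → (L.layer l ∩ L.layer l').Finite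

/-- `μ(L △ L')`: the total length, over all layers, of the symmetric difference. -/
noncomputable def symmDiffLength {m : ℕ} (L L' : LayeredPiece m) : ℝ :=
  ∑ l, (MeasureTheory.volume (symmDiff (L.layer l) (L'.layer l))).toReal

/-- Monotone valuation functions. -/
def MonotoneValuation {m : ℕ} (v : LayeredPiece m → ℝ) : Prop :=
  ∀ L L' : LayeredPiece m, (∀ l, L.layer l ⊆ L'.layer l) → v L ≤ v L'

/-- The Lipschitz condition with constant `K` for a valuation function. -/
def LipschitzValuation {m : ℕ} (K : ℝ) (v : LayeredPiece m → ℝ) : Prop :=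
  ∀ L L' : LayeredPiece m, |v L - v L'| ≤ K * symmDiffLength L L'

/-- `A` is a (complete) multi-division: its pieces cover every layer and, in every layer,
have pairwise disjoint interiors. -/
def IsMultiDivision {m q : ℕ} (A : Fin q → LayeredPiece m) : Prop :=
  (∀ l, (⋃ j, (A j).layer l) = Set.Icc (0 : ℝ) 1) ∧
  ∀ j j', j ≠ j' → ∀ l, Disjoint (interior ((A j).layer l)) (interior ((A j').layer l))

/-- All layered pieces are contiguous. -/
def IsContiguous {m q : ℕ} (A : Fin q → LayeredPiece m) : Prop :=
  ∀ j, (A j).Contiguous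

/-- All layered pieces are non-overlapping. -/
def IsFeasible {m q : ℕ} (A : Fin q → LayeredPiece m) : Prop :=
  ∀ j, (A j).NonOverlapping

/-- The division is obtained with one long knife (at position `x`, cutting all layers) and one
short knife (at position `y`, cutting only the layer `s`): apart from the two ends of the cake,
a part of layer `l` can begin or end only where a knife cuts the layer `l`. -/
def OneShortOneLongKnife {m q : ℕ} (A : Fin q → LayeredPiece m) : Prop :=
  ∃ (s : Fin m) (x y : ℝ), x ∈ Set.Icc (0 : ℝ) 1 ∧ y ∈ Set.Icc (0 : ℝ) 1 ∧
    ∀ j l, ∀ p ∈ frontier ((A j).layer l), p = 0 ∨ p = 1 ∨ p = x ∨ (l = s ∧ p = y)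

/-! ### The layered pieces that can be queried -/

theorem isPiece_Icc {a b : ℝ} (ha : 0 ≤ a) (hb : b ≤ 1) : IsPiece (Set.Icc a b) := by
  by_cases h : a ≤ b
  · exact ⟨{(a, b)}, by simp [ha, hb, h], by simp, by simp⟩
  · exact ⟨∅, by simp, by simp, by simp [h]⟩

/-- The contiguous layered piece of the two-layered cake consisting of the interval `[a,b]` of
layer `0` and the interval `[c,d]` of layer `1`, both intersected with `[0,1]`. -/
def intervalPiece (a b c d : ℝ) : LayeredPiece 2 where
  layer l := if l = 0 then Set.Icc (max a 0) (min b 1) else Set.Icc (max c 0) (min d 1)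
  isPiece l := by
    split_ifs <;> exact isPiece_Icc (le_max_right _ _) (min_le_right _ _)

/-! ### A machine model: real-number register programs with a valuation oracle

A program works on registers `R 0, R 1, R 2, …` holding real numbers. The elementary steps are
loading an integer constant, copying, the four arithmetic operations, comparing two
registers, and asking an agent for her value of a contiguous layered piece. Each
elementary step takes one unit of time. -/

inductive ArithOp
  | add
  | sub
  | mul
  | div

/-- Value of an arithmetic operation (division by zero returns `0`). -/
noncomputable def ArithOp.eval : ArithOp → ℝ → ℝ → ℝ
  | .add, x, y => x + y
  | .sub, x, y => x - y
  | .mul, x, y => x * y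
  | .div, x, y => x / y

inductive Prog
  /-- `R d := c` -/
  | const (d : ℕ) (c : ℤ)
  /-- `R d := R a` -/
  | copy (d a : ℕ)
  /-- `R d := R a op R b` -/
  | arith (op : ArithOp) (d a b : ℕ)
  /-- `R d :=` the value that agent number `R i` gives to the layered piece with the interval
  `[R a, R b]` in layer `0` and the interval `[R a', R b']` in layer `1` -/
  | query (d i a b a' b' : ℕ)
  /-- first `p`, then `p'` -/
  | seq (p p' : Prog)
  /-- if `R a < R b` then `p` else `p'` -/
  | ifLt (a b : ℕ) (p p' : Prog)
  /-- while `R a < R b` do `p` -/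
  | whileLt (a b : ℕ) (p : Prog)

/-- `Exec ask P s s' t`: started with register contents `s`, the program `P` halts with
register contents `s'` after exactly `t` elementary steps, where `ask r L` is the answer to
asking agent number `r` for her value of `L`. -/
inductive Exec (ask : ℝ → LayeredPiece 2 → ℝ) : Prog → (ℕ → ℝ) → (ℕ → ℝ) → ℕ → Prop
  | const (d : ℕ) (c : ℤ) (s : ℕ → ℝ) :
      Exec ask (.const d c) s (Function.update s d (c : ℝ)) 1
  | copy (d a : ℕ) (s : ℕ → ℝ) :
      Exec ask (.copy d a) s (Function.update s d (s a)) 1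
  | arith (op : ArithOp) (d a b : ℕ) (s : ℕ → ℝ) :
      Exec ask (.arith op d a b) s (Function.update s d (op.eval (s a) (s b))) 1
  | query (d i a b a' b' : ℕ) (s : ℕ → ℝ) :
      Exec ask (.query d i a b a' b') s
        (Function.update s d (ask (s i) (intervalPiece (s a) (s b) (s a') (s b')))) 1
  | seq {p p' : Prog} {s s' s'' : ℕ → ℝ} {t t' : ℕ} :
      Exec ask p s s' t → Exec ask p' s' s'' t' → Exec ask (.seq p p') s s'' (t + t')
  | ifTrue {a b : ℕ} {p p' : Prog} {s s' : ℕ → ℝ} {t : ℕ} :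
      s a < s b → Exec ask p s s' t → Exec ask (.ifLt a b p p') s s' (t + 1)
  | ifFalse {a b : ℕ} {p p' : Prog} {s s' : ℕ → ℝ} {t : ℕ} :
      ¬ s a < s b → Exec ask p' s s' t → Exec ask (.ifLt a b p p') s s' (t + 1)
  | whileTrue {a b : ℕ} {p : Prog} {s s' s'' : ℕ → ℝ} {t t' : ℕ} :
      s a < s b → Exec ask p s s' t → Exec ask (.whileLt a b p) s' s'' t' →
        Exec ask (.whileLt a b p) s s'' (t + t' + 1)
  | whileFalse {a b : ℕ} {p : Prog} {s : ℕ → ℝ} :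
      ¬ s a < s b → Exec ask (.whileLt a b p) s s 1

/-- The machine is deterministic: final contents and number of steps are unique. -/
theorem Exec.unique {ask : ℝ → LayeredPiece 2 → ℝ} {P : Prog} {s s₁ s₂ : ℕ → ℝ} {t₁ t₂ : ℕ}
    (h₁ : Exec ask P s s₁ t₁) (h₂ : Exec ask P s s₂ t₂) : s₁ = s₂ ∧ t₁ = t₂ := by
  induction h₁ generalizing s₂ t₂ with
  | const d c s => cases h₂; exact ⟨rfl, rfl⟩
  | copy d a s => cases h₂; exact ⟨rfl, rfl⟩
  | arith op d a b s => cases h₂; exact ⟨rfl, rfl⟩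
  | query d i a b a' b' s => cases h₂; exact ⟨rfl, rfl⟩
  | seq _ _ ih ih' =>
    cases h₂ with
    | seq g g' =>
      obtain ⟨rfl, rfl⟩ := ih g
      obtain ⟨rfl, rfl⟩ := ih' g'
      exact ⟨rfl, rfl⟩
  | ifTrue hc _ ih =>
    cases h₂ with
    | ifTrue _ g => obtain ⟨rfl, rfl⟩ := ih g; exact ⟨rfl, rfl⟩
    | ifFalse hc' _ => exact absurd hc hc'
  | ifFalse hc _ ih =>
    cases h₂ with
    | ifTrue hc' _ => exact absurd hc' hc
    | ifFalse _ g => obtain ⟨rfl, rfl⟩ := ih g; exact ⟨rfl, rfl⟩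
  | whileTrue hc _ _ ih ih' =>
    cases h₂ with
    | whileTrue _ g g' =>
      obtain ⟨rfl, rfl⟩ := ih g
      obtain ⟨rfl, rfl⟩ := ih' g'
      exact ⟨rfl, rfl⟩
    | whileFalse hc' => exact absurd hc hc'
  | whileFalse hc =>
    cases h₂ with
    | whileTrue hc' _ _ => exact absurd hc' hc
    | whileFalse _ => exact ⟨rfl, rfl⟩

open Classical in
/-- Access to the valuations `v` of `n` agents numbered `0, …, n - 1`. The agent number `n - 1`
is the birthday agent, who is not consulted: only the agents `0, …, n - 2` answer. A number
that is not that of such an agent is answered by `0`. -/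
noncomputable def oracle {m n : ℕ} (v : Fin n → LayeredPiece m → ℝ) (r : ℝ)
    (L : LayeredPiece m) : ℝ :=
  if h : ∃ i : Fin n, (i : ℕ) < n - 1 ∧ r = ((i : ℕ) : ℝ) then v h.choose L else 0

/-- Initial contents: the number of agents, the Lipschitz constant and the accuracy are in the
registers `0`, `1`, `2`; all other registers contain `0`. -/
def input (n : ℕ) (K ε : ℝ) : ℕ → ℝ := fun r =>
  if r = 0 then (n : ℝ) else if r = 1 then K else if r = 2 then ε else 0

/-- The final contents `s` list, in the registers `0, …, 11`, the two ends of the interval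
`(A j).layer l` for `j = 0, 1, 2` and `l = 0, 1`. -/
def Outputs (s : ℕ → ℝ) (A : Fin 3 → LayeredPiece 2) : Prop :=
  ∀ (j : Fin 3) (l : Fin 2), (A j).layer l =
    Set.Icc (s (4 * (j : ℕ) + 2 * (l : ℕ))) (s (4 * (j : ℕ) + 2 * (l : ℕ) + 1))

end LayeredCake

open LayeredCake

/-!
A division of the two-layered cake by a long knife at `x` and a short knife at `y` in layer `0`
is given by the parts
`[0,y]` of layer `0`;
`[max x y, 1]` of layer `0` and `[0,x]` of layer `1`;
`[y, max x y]` of layer `0` and `[x,1]` of layer `1`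
(`cut x y`, parts `0`, `1`, `2`). For every `x`, part `0` grows with `y` while the other two
parts shrink. So the weight of part `0`, that is the proportion of agents who vote for it, grows
with `y`. It is zero for `y = 0`, and at least a third for `y = 1` if layer `0` is the one that
more agents prefer. Hence some `y = y(x)` gives part `0` exactly a third of the votes. The
divisions for `x = 0` and `x = 1` with the same `y` differ only by an exchange of the parts `1`
and `2`. So, if part `1` has more votes than part `2` along `y(x)` for `x = 0`, then it has fewer
for `x = 1`, and somewhere in between all three parts get a third of the votes.

Two nested binary searches make this effective. Instead of points, the inner search finds
intervals `[p,q]` on which the votes for part `0` pass `N / 3`, where `N = n - 1` (`Crossing`);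
instead of comparing the parts `1` and `2`, the outer one tests whether part `1` has sufficiently
many votes and part `2` not too many at the ends of that interval (`Leans`). One of this
and the opposite statement is true for every crossing (`Crossing.leans`). Since `y(x)` need not be
continuous, the utility of part `0` gets a bonus `η * y`; then a small move of the short knife
outweighs a much smaller move of the long knife (`soloCount_zero_mono`), and crossings at close
positions of the long knife are close (`Crossing.lt_add`). By the Lipschitz condition, all votes
near the final position are for parts that are acceptable, up to `ε`, in the final division. So
every part is acceptable to a third of the agents, and is the only acceptable part for at most a
third of them (`balanced_of_crossings`). By Hall's theorem this is enough for the assignments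
(`exists_assignment`), whatever part the birthday agent takes.

The running time comes from `O(log (2 + K / ε))` rounds of each search and `O(n)` steps to count
the votes on one division.
-/

namespace LayeredCake

/-! ### Values of interval pieces -/

theorem volume_symmDiff_Icc_le (a b c d : ℝ) :
    (MeasureTheory.volume (symmDiff (Set.Icc a b) (Set.Icc c d))).toReal ≤ |a - c| + |b - d| := by
  have hsub : symmDiff (Set.Icc a b) (Set.Icc c d) ⊆ Set.uIcc a c ∪ Set.uIcc b d := by
    rintro z (⟨⟨h1, h2⟩, h3⟩ | ⟨⟨h1, h2⟩, h3⟩) <;>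
    · rw [Set.mem_Icc, not_and_or, not_le, not_le] at h3
      simp only [Set.mem_union, Set.mem_uIcc]
      rcases h3 with h3 | h3
      · left; first | exact Or.inl ⟨h1, h3.le⟩ | exact Or.inr ⟨h1, h3.le⟩
      · right; first | exact Or.inr ⟨h3.le, h2⟩ | exact Or.inl ⟨h3.le, h2⟩
  have h := (MeasureTheory.measure_mono (μ := MeasureTheory.volume) hsub).trans
    (MeasureTheory.measure_union_le _ _)
  rw [Real.volume_interval, Real.volume_interval,
    ← ENNReal.ofReal_add (abs_nonneg _) (abs_nonneg _)] at h
  have := ENNReal.toReal_mono ENNReal.ofReal_ne_top h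
  rw [ENNReal.toReal_ofReal (by positivity)] at this
  rwa [abs_sub_comm a c, abs_sub_comm b d]

theorem intervalPiece_layer_zero (a b c d : ℝ) :
    (intervalPiece a b c d).layer 0 = Set.Icc (max a 0) (min b 1) := by
  simp [intervalPiece]

theorem intervalPiece_layer_one (a b c d : ℝ) :
    (intervalPiece a b c d).layer 1 = Set.Icc (max c 0) (min d 1) := by
  simp [intervalPiece]

/-- A Lipschitz constant is nonnegative, because the cake has positive length. -/
theorem LipschitzValuation.nonneg {K : ℝ} {v : LayeredPiece 2 → ℝ}
    (hv : LipschitzValuation K v) : 0 ≤ K := by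
  have h := (abs_nonneg _).trans (hv (intervalPiece 0 1 0 1) (intervalPiece 1 0 1 0))
  have h2 : symmDiffLength (intervalPiece 0 1 0 1) (intervalPiece 1 0 1 0) = 2 := by
    have h0 : ∀ S : Set ℝ, symmDiff S ∅ = S := symmDiff_bot
    simp [symmDiffLength, intervalPiece, h0]
  rw [h2] at h
  linarith

theorem LipschitzValuation.intervalPiece_le {K : ℝ} {v : LayeredPiece 2 → ℝ}
    (hv : LipschitzValuation K v) (a b c d a' b' c' d' : ℝ) :
    v (intervalPiece a b c d) ≤ v (intervalPiece a' b' c' d') +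
      K * (|a - a'| + |b - b'| + |c - c'| + |d - d'|) := by
  have h := (le_abs_self _).trans (hv (intervalPiece a b c d) (intervalPiece a' b' c' d'))
  have h2 : symmDiffLength (intervalPiece a b c d) (intervalPiece a' b' c' d') ≤
      |a - a'| + |b - b'| + |c - c'| + |d - d'| := by
    simp only [symmDiffLength, Fin.sum_univ_two, intervalPiece_layer_zero,
      intervalPiece_layer_one]
    have e1 := volume_symmDiff_Icc_le (max a 0) (min b 1) (max a' 0) (min b' 1)
    have e2 := volume_symmDiff_Icc_le (max c 0) (min d 1) (max c' 0) (min d' 1)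
    have e3 : |max a 0 - max a' 0| ≤ |a - a'| := abs_max_sub_max_le_abs a a' 0
    have e4 : |max c 0 - max c' 0| ≤ |c - c'| := abs_max_sub_max_le_abs c c' 0
    have e5 : |min b 1 - min b' 1| ≤ |b - b'| := by
      simpa using abs_min_sub_min_le_max b 1 b' 1
    have e6 : |min d 1 - min d' 1| ≤ |d - d'| := by
      simpa using abs_min_sub_min_le_max d 1 d' 1
    linarith
  have := mul_le_mul_of_nonneg_left h2 hv.nonneg
  linarith

/-- Lipschitz valuations do not see an interval reduced to at most one point. -/
theorem LipschitzValuation.degenerate_zero {K : ℝ} {v : LayeredPiece 2 → ℝ}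
    (hv : LipschitzValuation K v) {a b a' b' : ℝ} (h : b ≤ a) (h' : b' ≤ a') (c d : ℝ) :
    v (intervalPiece a b c d) = v (intervalPiece a' b' c d) := by
  have key : symmDiffLength (intervalPiece a b c d) (intervalPiece a' b' c d) = 0 := by
    simp only [symmDiffLength, Fin.sum_univ_two, intervalPiece_layer_zero,
      intervalPiece_layer_one, symmDiff_self, Set.bot_eq_empty, MeasureTheory.measure_empty,
      ENNReal.toReal_zero, add_zero]
    have : MeasureTheory.volume (symmDiff (Set.Icc (max a 0) (min b 1))
        (Set.Icc (max a' 0) (min b' 1))) = 0 := by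
      refine MeasureTheory.measure_mono_null Set.symmDiff_subset_union
        (MeasureTheory.measure_union_null ?_ ?_) <;> rw [Real.volume_Icc] <;>
        refine ENNReal.ofReal_of_nonpos ?_
      · linarith [le_max_left a 0, min_le_left b 1]
      · linarith [le_max_left a' 0, min_le_left b' 1]
    rw [this, ENNReal.toReal_zero]
  have h := hv (intervalPiece a b c d) (intervalPiece a' b' c d)
  rw [key, mul_zero] at h
  exact sub_eq_zero.1 (abs_nonpos_iff.1 h)

/-- The layered piece with the two layers exchanged. -/
def swapLayers (L : LayeredPiece 2) : LayeredPiece 2 where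
  layer l := L.layer (1 - l)
  isPiece l := L.isPiece (1 - l)

theorem swapLayers_intervalPiece (a b c d : ℝ) :
    swapLayers (intervalPiece a b c d) = intervalPiece c d a b := by
  simp only [swapLayers, intervalPiece, LayeredPiece.mk.injEq]
  funext l
  fin_cases l <;> simp

theorem LipschitzValuation.swap {K : ℝ} {v : LayeredPiece 2 → ℝ}
    (hv : LipschitzValuation K v) : LipschitzValuation K (fun L => v (swapLayers L)) := by
  intro L L'
  have := hv (swapLayers L) (swapLayers L')
  have e : symmDiffLength (swapLayers L) (swapLayers L') = symmDiffLength L L' := by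
    simp [symmDiffLength, swapLayers, Fin.sum_univ_two, add_comm]
  rwa [e] at this

theorem MonotoneValuation.swap {v : LayeredPiece 2 → ℝ}
    (hv : MonotoneValuation v) : MonotoneValuation (fun L => v (swapLayers L)) :=
  fun _ _ h => hv _ _ fun l => h (1 - l)

theorem LipschitzValuation.degenerate_one {K : ℝ} {v : LayeredPiece 2 → ℝ}
    (hv : LipschitzValuation K v) {c d c' d' : ℝ} (h : d ≤ c) (h' : d' ≤ c') (a b : ℝ) :
    v (intervalPiece a b c d) = v (intervalPiece a b c' d') := by
  simpa only [swapLayers_intervalPiece] using hv.swap.degenerate_zero h h' a b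

theorem MonotoneValuation.intervalPiece_le {v : LayeredPiece 2 → ℝ}
    (hv : MonotoneValuation v) {a b c d a' b' c' d' : ℝ} (ha : a' ≤ a) (hb : b ≤ b')
    (hc : c' ≤ c) (hd : d ≤ d') :
    v (intervalPiece a b c d) ≤ v (intervalPiece a' b' c' d') := by
  refine hv _ _ fun l => ?_
  fin_cases l
  · exact Set.Icc_subset_Icc (max_le_max_right 0 ha) (min_le_min_right 1 hb)
  · exact Set.Icc_subset_Icc (max_le_max_right 0 hc) (min_le_min_right 1 hd)

/-! ### The divisions with long knife `x` and short knife `y` -/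

/-- The division into `[0,y]` in layer `0`, the two intervals `[max x y, 1]` in layer `0` and
`[0,x]` in layer `1`, and the two intervals `[y, max x y]` in layer `0` and `[x,1]` in
layer `1`. The interval with ends `1` and `0` is the empty one. -/
noncomputable def cut (x y : ℝ) (j : Fin 3) : LayeredPiece 2 :=
  if j = 0 then intervalPiece 0 y 1 0
  else if j = 1 then intervalPiece (max x y) 1 0 x
  else intervalPiece y (max x y) x 1

theorem cut_zero (x y : ℝ) : cut x y 0 = intervalPiece 0 y 1 0 := rfl
theorem cut_one (x y : ℝ) : cut x y 1 = intervalPiece (max x y) 1 0 x := rfl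
theorem cut_two (x y : ℝ) : cut x y 2 = intervalPiece y (max x y) x 1 := rfl

section Geometry

variable {x y : ℝ}

theorem cut_layer (hx : x ∈ Set.Icc (0 : ℝ) 1) (hy : y ∈ Set.Icc (0 : ℝ) 1) :
    (cut x y 0).layer 0 = Set.Icc 0 y ∧ (cut x y 0).layer 1 = Set.Icc 1 0 ∧
    (cut x y 1).layer 0 = Set.Icc (max x y) 1 ∧ (cut x y 1).layer 1 = Set.Icc 0 x ∧
    (cut x y 2).layer 0 = Set.Icc y (max x y) ∧ (cut x y 2).layer 1 = Set.Icc x 1 := by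
  have hm : 0 ≤ max x y := le_max_of_le_left hx.1
  have hm' : max x y ≤ 1 := max_le hx.2 hy.2
  simp only [cut_zero, cut_one, cut_two, intervalPiece_layer_zero, intervalPiece_layer_one,
    max_eq_left hm, min_eq_left hm', max_eq_left hx.1, max_eq_left hy.1, min_eq_left hx.2,
    min_eq_left hy.2, max_self, min_self, zero_le_one, max_eq_left, min_eq_left, and_self]

theorem isMultiDivision_cut (hx : x ∈ Set.Icc (0 : ℝ) 1) (hy : y ∈ Set.Icc (0 : ℝ) 1) :
    IsMultiDivision (cut x y) := by
  obtain ⟨h00, h01, h10, h11, h20, h21⟩ := cut_layer hx hy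
  have hm' : max x y ≤ 1 := max_le hx.2 hy.2
  have hd : ∀ {a b c d : ℝ}, b ≤ c → Disjoint (Set.Ioo a b) (Set.Ioo c d) := fun h =>
    Set.disjoint_left.2 fun z h1 h2 => absurd (h1.2.trans_le h) h2.1.not_gt
  have hd' : ∀ {a b c d : ℝ}, b ≤ c → Disjoint (Set.Ioo c d) (Set.Ioo a b) := fun h => (hd h).symm
  constructor
  · intro l
    ext z
    simp only [Set.mem_iUnion, Fin.exists_fin_succ, IsEmpty.exists_iff, or_false]
    fin_cases l
    · change z ∈ (cut x y 0).layer 0 ∨ z ∈ (cut x y 1).layer 0 ∨ z ∈ (cut x y 2).layer 0 ↔ _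
      rw [h00, h10, h20]
      simp only [Set.mem_Icc]
      have h1 := hy.1
      have h2 := le_max_right x y
      have h3 := hy.2
      constructor
      · rintro (h | h | h) <;> constructor <;> linarith
      · intro h
        rcases le_total z y with h4 | h4
        · exact Or.inl ⟨h.1, h4⟩
        rcases le_total z (max x y) with h5 | h5
        · exact Or.inr (Or.inr ⟨h4, h5⟩)
        · exact Or.inr (Or.inl ⟨h5, h.2⟩)
    · change z ∈ (cut x y 0).layer 1 ∨ z ∈ (cut x y 1).layer 1 ∨ z ∈ (cut x y 2).layer 1 ↔ _
      rw [h01, h11, h21]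
      simp only [Set.mem_Icc]
      have h1 := hx.1
      have h2 := hx.2
      constructor
      · rintro (h | h | h) <;> constructor <;> linarith
      · intro h
        rcases le_total z x with h4 | h4
        · exact Or.inr (Or.inl ⟨h.1, h4⟩)
        · exact Or.inr (Or.inr ⟨h4, h.2⟩)
  · intro j j' hj l
    fin_cases l <;> fin_cases j <;> fin_cases j' <;>
      first
      | exact absurd rfl hj
      | (simp only [Fin.zero_eta, Fin.mk_one, Fin.reduceFinMk, h00, h01, h10, h11, h20, h21,
          interior_Icc]
         first
         | exact hd le_rfl
         | exact hd' le_rfl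
         | exact hd (le_max_right _ _)
         | exact hd' (le_max_right _ _))

theorem isContiguous_cut (x y : ℝ) : IsContiguous (cut x y) := by
  intro j l
  unfold cut intervalPiece
  fin_cases l <;> fin_cases j <;> exact ⟨_, _, rfl⟩

theorem isFeasible_cut (hx : x ∈ Set.Icc (0 : ℝ) 1) (hy : y ∈ Set.Icc (0 : ℝ) 1) :
    IsFeasible (cut x y) := by
  obtain ⟨h00, h01, h10, h11, h20, h21⟩ := cut_layer hx hy
  have hfin : ∀ j, ((cut x y j).layer 0 ∩ (cut x y j).layer 1).Finite := by
    intro j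
    fin_cases j
    · simp [h01]
    · refine (Set.finite_singleton x).subset ?_
      simp only [Fin.mk_one, h10, h11]
      rintro z ⟨h1, h2⟩
      exact le_antisymm h2.2 ((le_max_left _ _).trans h1.1)
    · refine (Set.finite_singleton (max x y)).subset ?_
      simp only [Fin.reduceFinMk, h20, h21]
      rintro z ⟨h1, h2⟩
      exact le_antisymm h1.2 (max_le h2.1 h1.1)
  intro j l l' hl
  fin_cases l <;> fin_cases l' <;> first
    | exact absurd rfl hl
    | exact hfin j
    | (rw [Set.inter_comm]; exact hfin j)

theorem frontier_Icc_subset' (a b : ℝ) : frontier (Set.Icc a b) ⊆ {a, b} := by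
  rcases le_or_gt a b with h | h
  · rw [frontier_Icc h]
  · simp [Set.Icc_eq_empty h.not_ge]

theorem oneShortOneLongKnife_cut (hx : x ∈ Set.Icc (0 : ℝ) 1) (hy : y ∈ Set.Icc (0 : ℝ) 1) :
    OneShortOneLongKnife (cut x y) := by
  obtain ⟨h00, h01, h10, h11, h20, h21⟩ := cut_layer hx hy
  refine ⟨0, x, y, hx, hy, fun j l p hp => ?_⟩
  have hm : max x y = x ∨ max x y = y := max_choice x y
  fin_cases l <;> fin_cases j <;>
    simp only [Fin.zero_eta, Fin.mk_one, Fin.reduceFinMk, h00, h01, h10, h11, h20, h21] at hp <;>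
    have hp := frontier_Icc_subset' _ _ hp <;>
    simp only [Set.mem_insert_iff, Set.mem_singleton_iff] at hp <;>
    rcases hp with rfl | rfl <;> simp only [true_or, or_true] <;> tauto

theorem IsMultiDivision.swap {A : Fin 3 → LayeredPiece 2} (h : IsMultiDivision A) :
    IsMultiDivision (fun j => swapLayers (A j)) :=
  ⟨fun l => h.1 (1 - l), fun j j' hj l => h.2 j j' hj (1 - l)⟩

theorem IsContiguous.swap {A : Fin 3 → LayeredPiece 2} (h : IsContiguous A) :
    IsContiguous (fun j => swapLayers (A j)) :=
  fun j l => h j (1 - l)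

theorem IsFeasible.swap {A : Fin 3 → LayeredPiece 2} (h : IsFeasible A) :
    IsFeasible (fun j => swapLayers (A j)) :=
  fun j l l' hl => h j (1 - l) (1 - l') fun e => hl (sub_right_injective e)

theorem OneShortOneLongKnife.swap {A : Fin 3 → LayeredPiece 2} (h : OneShortOneLongKnife A) :
    OneShortOneLongKnife (fun j => swapLayers (A j)) := by
  obtain ⟨s, x, y, hx, hy, h⟩ := h
  refine ⟨1 - s, x, y, hx, hy, fun j l p hp => ?_⟩
  rcases h j (1 - l) p hp with h | h | h | ⟨h, h'⟩
  · exact Or.inl h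
  · exact Or.inr (Or.inl h)
  · exact Or.inr (Or.inr (Or.inl h))
  · exact Or.inr (Or.inr (Or.inr ⟨by rw [← h, sub_sub_cancel], h'⟩))

end Geometry

/-! ### Votes -/

theorem fin_three_cases (j : Fin 3) : j = 0 ∨ j = 1 ∨ j = 2 := by revert j; decide

theorem eq_one_or_two_of_ne_zero {j : Fin 3} (hj : j ≠ 0) : j = 1 ∨ j = 2 :=
  (fin_three_cases j).resolve_left hj

section Counts

variable {w : ℕ → LayeredPiece 2 → ℝ} {N : ℕ} {K η : ℝ}

/-- Utility of agent `i` for part `j` of `cut x y`; the bonus `η * y` for part `0` makes its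
utility increase at rate at least `η` when the short knife moves to the right. -/
noncomputable def util (w : ℕ → LayeredPiece 2 → ℝ) (η x y : ℝ) (i : ℕ) (j : Fin 3) : ℝ :=
  w i (cut x y j) + if j = 0 then η * y else 0

open Classical in
/-- The number of agents among `0, …, N - 1` for whom part `j` of `cut x y` is the only one of
maximal utility. -/
noncomputable def soloCount (w : ℕ → LayeredPiece 2 → ℝ) (N : ℕ) (η : ℝ) (j : Fin 3)
    (x y : ℝ) : ℕ :=
  ((Finset.range N).filter fun i => ∀ k, k ≠ j → util w η x y i k < util w η x y i j).card

open Classical in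
/-- The number of agents among `0, …, N - 1` for whom part `j` of `cut x y` has maximal
utility, possibly together with other parts. -/
noncomputable def topCount (w : ℕ → LayeredPiece 2 → ℝ) (N : ℕ) (η : ℝ) (j : Fin 3)
    (x y : ℝ) : ℕ :=
  ((Finset.range N).filter fun i => ∀ k, util w η x y i k ≤ util w η x y i j).card

theorem util_zero (x y : ℝ) (i : ℕ) : util w η x y i 0 = w i (cut x y 0) + η * y := by
  simp [util]

theorem util_of_ne {j : Fin 3} (hj : j ≠ 0) (x y : ℝ) (i : ℕ) :
    util w η x y i j = w i (cut x y j) := by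
  simp [util, hj]

theorem soloCount_le_topCount (j : Fin 3) (x y : ℝ) :
    soloCount w N η j x y ≤ topCount w N η j x y := by
  refine Finset.card_le_card (Finset.monotone_filter_right _ fun i _ hi k => ?_)
  rcases eq_or_ne k j with rfl | hk
  · exact le_rfl
  · exact (hi k hk).le

theorem le_soloCount_add_topCount (x y : ℝ) :
    N ≤ soloCount w N η 0 x y + topCount w N η 1 x y + topCount w N η 2 x y := by
  classical
  calc N = (Finset.range N).card := (Finset.card_range N).symm
    _ ≤ _ := Finset.card_le_card (t := _ ∪ _ ∪ _) ?_
    _ ≤ _ := Finset.card_union_le _ _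
    _ ≤ _ := Nat.add_le_add_right (Finset.card_union_le _ _) _
  intro i hi
  simp only [Finset.mem_union, Finset.mem_filter, hi, true_and, Fin.forall_fin_succ,
    IsEmpty.forall_iff, and_true, ne_eq]
  simp only [Fin.succ_zero_eq_one, Fin.succ_one_eq_two, not_true_eq_false, false_imp_iff,
    true_and, one_ne_zero, not_false_eq_true, true_imp_iff, le_refl, and_true,
    show (2 : Fin 3) ≠ 0 by decide]
  rcases le_total (util w η x y i 1) (util w η x y i 2) with h | h
  · rcases lt_or_ge (util w η x y i 2) (util w η x y i 0) with h' | h'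
    · exact Or.inl (Or.inl ⟨h.trans_lt h', h'⟩)
    · exact Or.inr ⟨h', h⟩
  · rcases lt_or_ge (util w η x y i 1) (util w η x y i 0) with h' | h'
    · exact Or.inl (Or.inl ⟨h', h.trans_lt h'⟩)
    · exact Or.inl (Or.inr ⟨h', h⟩)

theorem soloCount_add_le (x y : ℝ) :
    soloCount w N η 0 x y + soloCount w N η 1 x y + soloCount w N η 2 x y ≤ N := by
  classical
  have hd : ∀ j j' : Fin 3, j ≠ j' → Disjoint
      ((Finset.range N).filter fun i => ∀ k, k ≠ j → util w η x y i k < util w η x y i j)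
      ((Finset.range N).filter fun i => ∀ k, k ≠ j' → util w η x y i k < util w η x y i j') :=
    fun j j' hj => Finset.disjoint_filter.2 fun i _ h h' =>
      (h j' hj.symm).not_gt (h' j hj)
  unfold soloCount
  rw [← Finset.card_union_of_disjoint (hd 0 1 (by decide)), ← Finset.card_union_of_disjoint
    (Finset.disjoint_union_left.2 ⟨hd 0 2 (by decide), hd 1 2 (by decide)⟩)]
  exact (Finset.card_le_card (Finset.union_subset (Finset.union_subset (Finset.filter_subset _ _)
    (Finset.filter_subset _ _)) (Finset.filter_subset _ _))).trans_eq (Finset.card_range N)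

/-! ### How utilities depend on the knives -/

theorem cut_mono_zero (hm : ∀ i, MonotoneValuation (w i)) (i : ℕ) (x x' : ℝ) {y y' : ℝ}
    (h : y ≤ y') : w i (cut x y 0) ≤ w i (cut x' y' 0) :=
  (hm i).intervalPiece_le le_rfl h le_rfl le_rfl

/-- Moving the short knife to the right makes the parts `1` and `2` less valuable. -/
theorem cut_antitone (hm : ∀ i, MonotoneValuation (w i)) (hl : ∀ i, LipschitzValuation K (w i))
    (i : ℕ) {j : Fin 3} (hj : j ≠ 0) (x : ℝ) {y y' : ℝ} (h : y ≤ y') :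
    w i (cut x y' j) ≤ w i (cut x y j) := by
  have hj' : j = 1 ∨ j = 2 := eq_one_or_two_of_ne_zero hj
  rcases hj' with rfl | rfl
  · exact (hm i).intervalPiece_le (max_le_max_left x h) le_rfl le_rfl le_rfl
  · rw [cut_two, cut_two]
    rcases le_total y' x with h' | h'
    · rw [max_eq_left h', max_eq_left (h.trans h')]
      exact (hm i).intervalPiece_le h le_rfl le_rfl le_rfl
    · -- part `2` of the new division has only one point in layer `0`
      rw [max_eq_right h', (hl i).degenerate_zero (le_refl y') (le_refl y)]
      exact (hm i).intervalPiece_le le_rfl (le_max_right _ _) le_rfl le_rfl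

theorem cut_lipschitz (hl : ∀ i, LipschitzValuation K (w i)) (i : ℕ) (j : Fin 3)
    (x x' y y' : ℝ) :
    w i (cut x y j) ≤ w i (cut x' y' j) + K * (2 * (|x - x'| + |y - y'|)) := by
  have hK := (hl i).nonneg
  have hmax : |max x y - max x' y'| ≤ |x - x'| + |y - y'| :=
    (abs_max_sub_max_le_max x y x' y').trans (max_le_add_of_nonneg (abs_nonneg _) (abs_nonneg _))
  have hx := abs_nonneg (x - x')
  have hy := abs_nonneg (y - y')
  have hj' : j = 0 ∨ j = 1 ∨ j = 2 := fin_three_cases j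
  rcases hj' with rfl | rfl | rfl
  all_goals
    refine ((hl i).intervalPiece_le _ _ _ _ _ _ _ _).trans
      (add_le_add_right (mul_le_mul_of_nonneg_left ?_ hK) _)
    simp only [sub_self, abs_zero]
    linarith

theorem cut_lipschitz_long (hl : ∀ i, LipschitzValuation K (w i)) (i : ℕ) (j : Fin 3)
    (x x' y : ℝ) : w i (cut x y j) ≤ w i (cut x' y j) + 2 * K * |x - x'| := by
  have := cut_lipschitz hl i j x x' y y
  rw [sub_self, abs_zero, add_zero] at this
  linarith

/-- Moving the short knife to the right by `y' - y` wins more votes for part `0` than a move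
of the long knife by at most `η * (y' - y) / (2 * K)` can cost. -/
theorem soloCount_zero_mono (hm : ∀ i, MonotoneValuation (w i))
    (hl : ∀ i, LipschitzValuation K (w i)) {x x' y y' : ℝ} (h : y ≤ y')
    (hx : 2 * K * |x' - x| ≤ η * (y' - y)) :
    soloCount w N η 0 x y ≤ soloCount w N η 0 x' y' := by
  refine Finset.card_le_card (Finset.monotone_filter_right _ fun i _ hi k hk => ?_)
  have h1 := hi k hk
  rw [util_zero, util_of_ne hk] at h1 ⊢
  have h2 := cut_mono_zero hm i x x' h
  have h3 := cut_antitone hm hl i hk x h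
  have h4 := cut_lipschitz_long hl i k x' x y'
  rw [mul_sub] at hx
  linarith

theorem soloCount_zero_at_zero (hm : ∀ i, MonotoneValuation (w i))
    (hl : ∀ i, LipschitzValuation K (w i)) (x : ℝ) : soloCount w N η 0 x 0 = 0 := by
  classical
  refine Finset.card_eq_zero.2 (Finset.filter_eq_empty_iff.2 fun i _ h => ?_)
  have h1 := h 1 (by decide)
  rw [util_zero, util_of_ne (by decide), cut_zero, cut_one, mul_zero, add_zero,
    (hl i).degenerate_zero (le_refl 0) (le_add_of_nonneg_left (le_max_right x 0)),
    (hl i).degenerate_one zero_le_one (min_le_right x 0)] at h1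
  exact h1.not_ge ((hm i).intervalPiece_le (le_add_of_nonneg_right zero_le_one) le_rfl le_rfl
    (min_le_left _ _))

/-- With the short knife at `1`, part `0` is a whole layer, and the other layer as a whole is
its strongest competitor. -/
theorem soloCount_zero_at_one (hm : ∀ i, MonotoneValuation (w i)) {x : ℝ}
    (hx : x ∈ Set.Icc (0 : ℝ) 1) : soloCount w N η 0 1 1 ≤ soloCount w N η 0 x 1 := by
  refine Finset.card_le_card (Finset.monotone_filter_right _ fun i _ hi k hk => ?_)
  rw [util_zero, util_of_ne hk]
  have hk' : k = 1 ∨ k = 2 := eq_one_or_two_of_ne_zero hk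
  have h1 := hi 1 (by decide)
  rw [util_zero, util_of_ne (by decide)] at h1
  have h2 : w i (cut x 1 k) ≤ w i (cut 1 1 1) := by
    rcases hk' with rfl | rfl
    · simp only [cut_one, max_eq_right hx.2, max_self]
      exact (hm i).intervalPiece_le le_rfl le_rfl le_rfl hx.2
    · simp only [cut_one, cut_two, max_eq_right hx.2, max_self]
      exact (hm i).intervalPiece_le le_rfl le_rfl hx.1 le_rfl
  exact h2.trans_lt h1

/-- If less than a third of the agents vote for layer `0` against layer `1`, then at least a
third vote for layer `1` against layer `0`. -/
theorem soloCount_swap (hm : ∀ i, MonotoneValuation (w i))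
    (hl : ∀ i, LipschitzValuation K (w i)) (hη : 0 < η) (h : 3 * soloCount w N η 0 1 1 < N) :
    N ≤ 3 * soloCount (fun i L => w i (swapLayers L)) N η 0 1 1 := by
  classical
  have key : N ≤ soloCount w N η 0 1 1 +
      soloCount (fun i L => w i (swapLayers L)) N η 0 1 1 := by
    calc N = (Finset.range N).card := (Finset.card_range N).symm
      _ ≤ _ := Finset.card_le_card (t := _ ∪ _) ?_
      _ ≤ _ := Finset.card_union_le _ _
    intro i hi
    simp only [Finset.mem_union, Finset.mem_filter, hi, true_and]
    by_contra hcon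
    push Not at hcon
    obtain ⟨⟨k, hk, h1⟩, ⟨l, hl', h2⟩⟩ := hcon
    rw [util_zero, util_of_ne hk] at h1
    rw [util_zero, util_of_ne hl'] at h2
    have hk' : k = 1 ∨ k = 2 := eq_one_or_two_of_ne_zero hk
    have hl'' : l = 1 ∨ l = 2 := eq_one_or_two_of_ne_zero hl'
    have e1 : w i (cut 1 1 k) ≤ w i (intervalPiece 1 1 0 1) := by
      rcases hk' with rfl | rfl
      · simp [cut_one]
      · rw [cut_two, max_self]
        exact (hm i).intervalPiece_le le_rfl le_rfl zero_le_one le_rfl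
    have e2 : w i (swapLayers (cut 1 1 l)) ≤ w i (intervalPiece 0 1 1 1) := by
      rcases hl'' with rfl | rfl
      · rw [cut_one, max_self, swapLayers_intervalPiece]
      · rw [cut_two, max_self, swapLayers_intervalPiece]
        exact (hm i).intervalPiece_le zero_le_one le_rfl le_rfl le_rfl
    rw [cut_zero] at h1
    rw [cut_zero, swapLayers_intervalPiece] at h2
    rw [(hl i).degenerate_one (le_refl 1) zero_le_one] at e2
    rw [(hl i).degenerate_zero (le_refl 1) zero_le_one] at e1
    linarith
  omega

/-! ### Crossings -/

/-- At the position `x` of the long knife, the votes for part `0` pass the value `N / 3` when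
the short knife moves from `p` to `q`, which is a distance at most `δ`. -/
structure Crossing (w : ℕ → LayeredPiece 2 → ℝ) (N : ℕ) (η δ x p q : ℝ) : Prop where
  nonneg : 0 ≤ p
  le : p ≤ q
  le_one : q ≤ 1
  dist_le : q - p ≤ δ
  lower : 3 * soloCount w N η 0 x p < N
  upper : N ≤ 3 * soloCount w N η 0 x q

/-- At the ends of a crossing, enough agents vote for part `j` and not too many for part `k`. -/
def Leans (w : ℕ → LayeredPiece 2 → ℝ) (N : ℕ) (η : ℝ) (j k : Fin 3) (x p q : ℝ) : Prop :=
  (N ≤ 3 * topCount w N η j x p ∨ N ≤ 3 * topCount w N η j x q) ∧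
    (3 * soloCount w N η k x p ≤ N ∨ 3 * soloCount w N η k x q ≤ N)

/-- Every crossing leans to one of the parts `1` and `2`, because few votes for part `0` leave
many for the other two parts together, and vice versa. -/
theorem Crossing.leans {δ x p q : ℝ} (h : Crossing w N η δ x p q)
    (hn : ¬ Leans w N η 1 2 x p q) : Leans w N η 2 1 x p q := by
  have h1 := h.lower
  have h2 := h.upper
  have h3 := le_soloCount_add_topCount (w := w) (N := N) (η := η) x p
  have h4 := soloCount_add_le (w := w) (N := N) (η := η) x q
  have h5 := soloCount_le_topCount (w := w) (N := N) (η := η) 1 x p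
  have h6 := soloCount_le_topCount (w := w) (N := N) (η := η) 2 x p
  unfold Leans at hn ⊢
  omega

/-- If the long knife is at one of the two ends of the cake, moving it to the other end
exchanges the parts `1` and `2`. -/
theorem util_end_swap (hl : ∀ i, LipschitzValuation K (w i)) {y : ℝ}
    (hy : y ∈ Set.Icc (0 : ℝ) 1) (i : ℕ) (j : Fin 3) :
    util w η 1 y i (Equiv.swap 1 2 j) = util w η 0 y i j := by
  have hj' : j = 0 ∨ j = 1 ∨ j = 2 := fin_three_cases j
  rcases hj' with rfl | rfl | rfl
  · rw [Equiv.swap_apply_of_ne_of_ne (by decide) (by decide)]; rfl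
  · rw [Equiv.swap_apply_left, util_of_ne (by decide), util_of_ne (by decide), cut_one, cut_two,
      max_eq_right hy.1, max_eq_left hy.2]
    exact (hl i).degenerate_one le_rfl le_rfl _ _
  · rw [Equiv.swap_apply_right, util_of_ne (by decide), util_of_ne (by decide), cut_one, cut_two,
      max_eq_right hy.1, max_eq_left hy.2]
    exact (hl i).degenerate_zero le_rfl le_rfl _ _

theorem soloCount_end_swap (hl : ∀ i, LipschitzValuation K (w i)) {y : ℝ}
    (hy : y ∈ Set.Icc (0 : ℝ) 1) (j : Fin 3) :
    soloCount w N η (Equiv.swap 1 2 j) 1 y = soloCount w N η j 0 y := by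
  classical
  unfold soloCount
  congr 1
  refine Finset.filter_congr fun i _ => ?_
  rw [← (Equiv.swap (1 : Fin 3) 2).forall_congr_right]
  simp only [util_end_swap hl hy, ne_eq, EmbeddingLike.apply_eq_iff_eq]

theorem topCount_end_swap (hl : ∀ i, LipschitzValuation K (w i)) {y : ℝ}
    (hy : y ∈ Set.Icc (0 : ℝ) 1) (j : Fin 3) :
    topCount w N η (Equiv.swap 1 2 j) 1 y = topCount w N η j 0 y := by
  classical
  unfold topCount
  congr 1
  refine Finset.filter_congr fun i _ => ?_
  rw [← (Equiv.swap (1 : Fin 3) 2).forall_congr_right]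
  simp only [util_end_swap hl hy]

theorem Crossing.end_swap (hl : ∀ i, LipschitzValuation K (w i)) {δ p q : ℝ}
    (h : Crossing w N η δ 0 p q) : Crossing w N η δ 1 p q := by
  refine ⟨h.nonneg, h.le, h.le_one, h.dist_le, ?_, ?_⟩
  · have := soloCount_end_swap (N := N) (η := η) hl ⟨h.nonneg, h.le.trans h.le_one⟩ 0
    rw [Equiv.swap_apply_of_ne_of_ne (by decide) (by decide)] at this
    rw [this]; exact h.lower
  · have := soloCount_end_swap (N := N) (η := η) hl ⟨h.nonneg.trans h.le, h.le_one⟩ 0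
    rw [Equiv.swap_apply_of_ne_of_ne (by decide) (by decide)] at this
    rw [this]; exact h.upper

theorem Leans.end_swap (hl : ∀ i, LipschitzValuation K (w i)) {p q : ℝ}
    (hp : p ∈ Set.Icc (0 : ℝ) 1) (hq : q ∈ Set.Icc (0 : ℝ) 1) {j k : Fin 3}
    (h : Leans w N η j k 0 p q) :
    Leans w N η (Equiv.swap 1 2 j) (Equiv.swap 1 2 k) 1 p q := by
  unfold Leans
  rw [topCount_end_swap hl hp, topCount_end_swap hl hq, soloCount_end_swap hl hp,
    soloCount_end_swap hl hq]
  exact h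

/-- Crossings at close positions of the long knife are close: otherwise the votes for part `0`,
having reached `N / 3` at `q`, would still be sufficient at `p'`. -/
theorem Crossing.lt_add (hm : ∀ i, MonotoneValuation (w i))
    (hl : ∀ i, LipschitzValuation K (w i)) {δ x x' p q p' q' : ℝ} (hδ : 0 ≤ δ)
    (hx : 2 * K * |x' - x| ≤ η * δ) (hη : 0 ≤ η)
    (h : Crossing w N η δ x p q) (h' : Crossing w N η δ x' p' q') : p' < p + 2 * δ := by
  by_contra hcon
  have h1 := h.dist_le
  have h2 : q + δ ≤ p' := by linarith
  have h3 := soloCount_zero_mono (N := N) hm hl (y := q) (y' := p') (x := x) (x' := x')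
    (η := η) (by linarith) (hx.trans (mul_le_mul_of_nonneg_left (by linarith) hη))
  have := h.upper
  have := h'.lower
  omega

/-! ### Nearby votes -/

/-- Agent `i` values part `j` of `cut x y` at most `ε` less than any other part. -/
def Accepts (w : ℕ → LayeredPiece 2 → ℝ) (ε x y : ℝ) (i : ℕ) (j : Fin 3) : Prop :=
  ∀ k, w i (cut x y k) ≤ w i (cut x y j) + ε

theorem accepts_of_top (hl : ∀ i, LipschitzValuation K (w i)) {ε x y x' y' : ℝ}
    (hη : 0 ≤ η) (hy : y' ∈ Set.Icc (0 : ℝ) 1)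
    (hd : 4 * K * (|x' - x| + |y' - y|) + η ≤ ε) {i : ℕ} {j : Fin 3}
    (h : ∀ k, util w η x' y' i k ≤ util w η x' y' i j) : Accepts w ε x y i j := by
  intro k
  have h1 := cut_lipschitz hl i k x x' y y'
  have h2 := cut_lipschitz hl i j x' x y' y
  rw [abs_sub_comm x x', abs_sub_comm y y'] at h1
  have h3 := h k
  have b1 : w i (cut x' y' k) ≤ util w η x' y' i k := by
    unfold util
    split_ifs
    · exact le_add_of_nonneg_right (mul_nonneg hη hy.1)
    · simp
  have b2 : util w η x' y' i j ≤ w i (cut x' y' j) + η := by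
    unfold util
    split_ifs
    · exact add_le_add_right (mul_le_of_le_one_right hη hy.2) _
    · simpa using hη
  linarith

open Classical in
theorem topCount_le_card_accepts (hl : ∀ i, LipschitzValuation K (w i)) {ε x y x' y' : ℝ}
    (hη : 0 ≤ η) (hy : y' ∈ Set.Icc (0 : ℝ) 1)
    (hd : 4 * K * (|x' - x| + |y' - y|) + η ≤ ε) (j : Fin 3) :
    topCount w N η j x' y' ≤ ((Finset.range N).filter fun i => Accepts w ε x y i j).card :=
  Finset.card_le_card (Finset.monotone_filter_right _ fun _ _ h =>
    accepts_of_top hl hη hy hd h)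

open Classical in
theorem card_accepts_only_le_soloCount (hl : ∀ i, LipschitzValuation K (w i))
    {ε x y x' y' : ℝ} (hη : 0 ≤ η) (hy : y' ∈ Set.Icc (0 : ℝ) 1)
    (hd : 4 * K * (|x' - x| + |y' - y|) + η ≤ ε) (j : Fin 3) :
    ((Finset.range N).filter fun i => ∀ k, Accepts w ε x y i k → k = j).card ≤
      soloCount w N η j x' y' := by
  refine Finset.card_le_card (Finset.monotone_filter_right _ fun i _ h k hk => ?_)
  obtain ⟨t, ht⟩ := Finite.exists_max (util w η x' y' i)
  obtain rfl := h t (accepts_of_top hl hη hy hd ht)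
  by_contra hcon
  exact hk (h k (accepts_of_top hl hη hy hd fun l => (ht l).trans (not_lt.1 hcon)))

open Classical in
/-- Every part is accepted by a third of the agents, and is the only accepted part for at most
a third of them. -/
def BalancedVotes (w : ℕ → LayeredPiece 2 → ℝ) (N : ℕ) (ε x y : ℝ) : Prop :=
  ∀ j, N ≤ 3 * ((Finset.range N).filter fun i => Accepts w ε x y i j).card ∧
    3 * ((Finset.range N).filter fun i => ∀ k, Accepts w ε x y i k → k = j).card ≤ N

/-- The votes at crossings near `(x, p)` that lean to different parts bound the numbers of agents
who accept the parts of `cut x p`: part `0` is controlled by the crossing itself, and each of the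
parts `1` and `2` from below by one crossing and from above by the other one. -/
theorem balanced_of_crossings (hm : ∀ i, MonotoneValuation (w i))
    (hl : ∀ i, LipschitzValuation K (w i)) {ε δ d x p q u pu qu z pz qz : ℝ} (hη : 0 ≤ η)
    (hδ : 0 ≤ δ) (hd : 2 * K * d ≤ η * δ) (hε : 4 * K * (d + 3 * δ) + η ≤ ε)
    (h : Crossing w N η δ x p q) (hu : Crossing w N η δ u pu qu) (hz : Crossing w N η δ z pz qz)
    (hxu : |u - x| ≤ d) (hxz : |z - x| ≤ d)
    (lu : Leans w N η 1 2 u pu qu) (lz : Leans w N η 2 1 z pz qz) : BalancedVotes w N ε x p := by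
  classical
  have hK := (hl 0).nonneg
  have near : ∀ {x' p' q' : ℝ}, Crossing w N η δ x' p' q' → |x' - x| ≤ d →
      (p' ∈ Set.Icc (0 : ℝ) 1 ∧ 4 * K * (|x' - x| + |p' - p|) + η ≤ ε) ∧
      (q' ∈ Set.Icc (0 : ℝ) 1 ∧ 4 * K * (|x' - x| + |q' - p|) + η ≤ ε) := by
    intro x' p' q' h' hx'
    have hx1 : 2 * K * |x' - x| ≤ η * δ :=
      (mul_le_mul_of_nonneg_left hx' (by positivity)).trans hd
    have c1 := h.lt_add hm hl hδ hx1 hη h'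
    rw [abs_sub_comm] at hx1
    have c2 := h'.lt_add hm hl hδ hx1 hη h
    have c3 := h'.le
    have c4 := h'.dist_le
    refine ⟨⟨⟨h'.nonneg, h'.le.trans h'.le_one⟩, ?_⟩,
      ⟨⟨h'.nonneg.trans h'.le, h'.le_one⟩, ?_⟩⟩ <;>
    · refine le_trans (add_le_add_left (mul_le_mul_of_nonneg_left (add_le_add hx' ?_)
        (by positivity)) _) hε
      rw [abs_le]
      constructor <;> linarith
  obtain ⟨⟨pu1, pu2⟩, ⟨qu1, qu2⟩⟩ := near hu hxu
  obtain ⟨⟨pz1, pz2⟩, ⟨qz1, qz2⟩⟩ := near hz hxz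
  have hU : ∀ {x' p' q' : ℝ} {j : Fin 3},
      (p' ∈ Set.Icc (0 : ℝ) 1 ∧ 4 * K * (|x' - x| + |p' - p|) + η ≤ ε) ∧
      (q' ∈ Set.Icc (0 : ℝ) 1 ∧ 4 * K * (|x' - x| + |q' - p|) + η ≤ ε) →
      (N ≤ 3 * topCount w N η j x' p' ∨ N ≤ 3 * topCount w N η j x' q') →
      N ≤ 3 * ((Finset.range N).filter fun i => Accepts w ε x p i j).card := by
    rintro x' p' q' j ⟨⟨a1, a2⟩, ⟨b1, b2⟩⟩ (h | h)
    · exact h.trans (Nat.mul_le_mul_left 3 (topCount_le_card_accepts hl hη a1 a2 j))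
    · exact h.trans (Nat.mul_le_mul_left 3 (topCount_le_card_accepts hl hη b1 b2 j))
  have hL : ∀ {x' p' q' : ℝ} {j : Fin 3},
      (p' ∈ Set.Icc (0 : ℝ) 1 ∧ 4 * K * (|x' - x| + |p' - p|) + η ≤ ε) ∧
      (q' ∈ Set.Icc (0 : ℝ) 1 ∧ 4 * K * (|x' - x| + |q' - p|) + η ≤ ε) →
      (3 * soloCount w N η j x' p' ≤ N ∨ 3 * soloCount w N η j x' q' ≤ N) →
      3 * ((Finset.range N).filter fun i => ∀ k, Accepts w ε x p i k → k = j).card ≤ N := by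
    rintro x' p' q' j ⟨⟨a1, a2⟩, ⟨b1, b2⟩⟩ (h | h)
    · exact (Nat.mul_le_mul_left 3 (card_accepts_only_le_soloCount hl hη a1 a2 j)).trans h
    · exact (Nat.mul_le_mul_left 3 (card_accepts_only_le_soloCount hl hη b1 b2 j)).trans h
  intro j
  have hj' : j = 0 ∨ j = 1 ∨ j = 2 := fin_three_cases j
  rcases hj' with rfl | rfl | rfl
  · exact ⟨hU (near hu hxu) (Or.inr (hu.upper.trans (Nat.mul_le_mul_left 3
      (soloCount_le_topCount _ _ _)))), hL (near hu hxu) (Or.inl hu.lower.le)⟩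
  · exact ⟨hU (near hu hxu) lu.1, hL (near hz hxz) lz.2⟩
  · exact ⟨hU (near hz hxz) lz.1, hL (near hu hxu) lu.2⟩

end Counts

/-! ### From votes to assignments -/

open Classical in
/-- Hall's theorem, with `⌊N / 3⌋` places at part `jstar` and `⌈N / 3⌉` places at each of the
other two parts. Agents who accept only one part are at most `⌊N / 3⌋`, and those who reject a
given part are at most `N - ⌈N / 3⌉`, which is at most `⌊N / 3⌋ + ⌈N / 3⌉`. -/
theorem exists_assignment (N : ℕ) (acc : ℕ → Fin 3 → Prop)
    (h₁ : ∀ j, N ≤ 3 * ((Finset.range N).filter fun i => acc i j).card)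
    (h₂ : ∀ j, 3 * ((Finset.range N).filter fun i => ∀ k, acc i k → k = j).card ≤ N)
    (hne : ∀ i, ∃ j, acc i j) (jstar : Fin 3) :
    ∃ π : ℕ → Fin 3, (∀ i < N, acc i (π i)) ∧
      ∀ j, ((Finset.range N).filter fun i => π i = j).card ≤
        if j = jstar then N / 3 else (N + 2) / 3 := by
  set cap : Fin 3 → ℕ := fun j => if j = jstar then N / 3 else (N + 2) / 3 with hcap
  have hcap1 : ∀ j, N / 3 ≤ cap j := fun j => by simp only [hcap]; split_ifs <;> omega
  have hsum : ∑ j, cap j = N / 3 + 2 * ((N + 2) / 3) := by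
    rcases fin_three_cases jstar with rfl | rfl | rfl <;>
      simp [hcap, Fin.sum_univ_three] <;> ring
  have hcap2 : ∀ j, cap j ≤ (N + 2) / 3 := fun j => by simp only [hcap]; split_ifs <;> omega
  -- the places at the parts that agent `i` accepts
  let places : Fin N → Finset (Σ _ : Fin 3, ℕ) := fun i =>
    (Finset.univ.filter fun j => acc i j).sigma fun j => Finset.range (cap j)
  obtain ⟨f, hf, hfp⟩ := (Finset.all_card_le_biUnion_card_iff_exists_injective places).1 (by
    intro X
    set S : Finset (Fin 3) := Finset.univ.filter fun j => ∃ i ∈ X, acc i j with hS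
    have e : X.biUnion places = S.sigma fun j => Finset.range (cap j) := by
      ext ⟨j, a⟩
      simp only [Finset.mem_biUnion, Finset.mem_sigma, Finset.mem_filter, Finset.mem_univ,
        true_and, Finset.mem_range, places, hS]
      constructor
      · rintro ⟨i, hi, h, h'⟩; exact ⟨⟨i, hi, h⟩, h'⟩
      · rintro ⟨⟨i, hi, h⟩, h'⟩; exact ⟨i, hi, h, h'⟩
    have memS : ∀ {j}, j ∈ S ↔ ∃ i ∈ X, acc i j := by simp [hS]
    rw [e, Finset.card_sigma]
    simp only [Finset.card_range]
    have hXcard : X.card = (X.map Fin.valEmbedding).card := (Finset.card_map _).symm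
    have hXN : X.card ≤ N := (Finset.card_le_univ X).trans_eq (Fintype.card_fin N)
    by_cases hall : S = Finset.univ
    · rw [hall, hsum]; omega
    obtain ⟨l, hl⟩ : ∃ l, l ∉ S := by
      by_contra! hcon
      exact hall (Finset.eq_univ_iff_forall.2 hcon)
    have hXl : ∀ i ∈ X, ¬ acc i l := fun i hi h => hl (memS.2 ⟨i, hi, h⟩)
    by_cases hone : ∃ j, ∀ k ∈ S, k = j
    · obtain ⟨j, hj⟩ := hone
      have h3 : X.card ≤ ((Finset.range N).filter fun i => ∀ k, acc i k → k = j).card := by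
        rw [hXcard]
        refine Finset.card_le_card fun i hi => ?_
        obtain ⟨i, hiX, rfl⟩ := Finset.mem_map.1 hi
        refine Finset.mem_filter.2 ⟨Finset.mem_range.2 i.2, fun k hk => hj k (memS.2 ⟨i, hiX, hk⟩)⟩
      rcases X.eq_empty_or_nonempty with rfl | ⟨i, hi⟩
      · simp
      obtain ⟨k, hk⟩ := hne i
      have hkS : k ∈ S := memS.2 ⟨i, hi, hk⟩
      have h4 := Finset.single_le_sum (f := cap) (fun _ _ => Nat.zero_le _) hkS
      have h5 := h₂ j
      have h6 := hcap1 k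
      omega
    · -- exactly the part `l` is missing
      have hSl : S = Finset.univ.erase l := by
        push Not at hone
        have hcard : 2 ≤ S.card := by
          by_contra! hlt
          have := Finset.card_le_one.1 (Nat.lt_succ_iff.1 hlt)
          obtain ⟨a, ha, -⟩ := hone l
          obtain ⟨b, hb, hab⟩ := hone a
          exact hab (this b hb a ha)
        refine Finset.eq_of_subset_of_card_le (fun k hk => Finset.mem_erase.2
          ⟨fun e => hl (e ▸ hk), Finset.mem_univ _⟩) ?_
        simpa [Finset.card_erase_of_mem] using hcard
      have h3 : X.card + ((Finset.range N).filter fun i => acc i l).card ≤ N := by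
        rw [hXcard, ← Finset.card_union_of_disjoint]
        · refine (Finset.card_le_card (t := Finset.range N) (Finset.union_subset (fun i hi => ?_)
            (Finset.filter_subset _ _))).trans_eq (Finset.card_range N)
          obtain ⟨i, hiX, rfl⟩ := Finset.mem_map.1 hi
          exact Finset.mem_range.2 i.2
        · refine Finset.disjoint_left.2 fun i hi hi' => ?_
          obtain ⟨i, hiX, rfl⟩ := Finset.mem_map.1 hi
          exact hXl i hiX (Finset.mem_filter.1 hi').2
      have h4 := Finset.add_sum_erase Finset.univ cap (Finset.mem_univ l)
      rw [hsum] at h4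
      rw [hSl]
      have h5 := h₁ l
      have h6 := hcap2 l
      omega)
  refine ⟨fun i => if h : i < N then (f ⟨i, h⟩).1 else 0, fun i hi => ?_, fun j => ?_⟩
  · have := hfp ⟨i, hi⟩
    simp only [places, Finset.mem_sigma, Finset.mem_filter, Finset.mem_univ, true_and] at this
    simpa only [hi, dite_true] using this.1
  · change _ ≤ cap j
    rw [← Finset.card_range (cap j)]
    refine Finset.card_le_card_of_injOn (fun i => if h : i < N then (f ⟨i, h⟩).2 else 0) ?_ ?_
    · intro i hi
      simp only [Finset.coe_filter, Finset.mem_range, Set.mem_ofPred_eq] at hi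
      have := hfp ⟨i, hi.1⟩
      simp only [places, Finset.mem_sigma, Finset.mem_filter, Finset.mem_univ, true_and] at this
      simp only [hi.1, dite_true, Finset.coe_range, Set.mem_Iio]
      have h2 := hi.2
      simp only [hi.1, dite_true] at h2
      exact (Finset.mem_range.1 this.2).trans_eq (congrArg cap h2)
    · intro i hi i' hi' he
      simp only [Finset.coe_filter, Finset.mem_range, Set.mem_ofPred_eq] at hi hi'
      have h1 := hi.2
      have h2 := hi'.2
      simp only [hi.1, hi'.1, dite_true] at h1 h2 he
      have := hf (Sigma.ext (h1.trans h2.symm) (heq_of_eq he))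
      simpa using this

/-- The birthday agent, who is the last one, takes part `jstar`; the numbers of agents of the
three parts are then as equal as possible. -/
theorem exists_birthday_assignment (N : ℕ) (acc : ℕ → Fin 3 → Prop) (jstar : Fin 3)
    {π : ℕ → Fin 3} (hacc : ∀ i < N, acc i (π i))
    (hπ : ∀ j, ((Finset.range N).filter fun i => π i = j).card ≤
        if j = jstar then N / 3 else (N + 2) / 3) :
    ∃ σ : Fin (N + 1) → Fin 3, σ (Fin.last N) = jstar ∧
      (∀ i : Fin (N + 1), (i : ℕ) < N → acc i (σ i)) ∧
      ∀ j, (Finset.univ.filter fun i => σ i = j).card = ⌊((N + 1 : ℕ) : ℚ) / 3⌋₊ ∨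
        (Finset.univ.filter fun i => σ i = j).card = ⌈((N + 1 : ℕ) : ℚ) / 3⌉₊ := by
  refine ⟨fun i => if (i : ℕ) < N then π i else jstar, by simp, fun i hi => ?_, ?_⟩
  · simpa only [hi, if_true] using hacc i hi
  have hcount : ∀ j, (Finset.univ.filter fun i : Fin (N + 1) =>
      (if (i : ℕ) < N then π i else jstar) = j).card =
      ((Finset.range N).filter fun i => π i = j).card + if jstar = j then 1 else 0 := by
    intro j
    rw [Finset.card_filter, Finset.card_filter,
      Fin.sum_univ_eq_sum_range (fun i => if (if i < N then π i else jstar) = j then 1 else 0),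
      Finset.sum_range_succ]
    simp only [lt_irrefl, if_false]
    congr 1
    exact Finset.sum_congr rfl fun i hi => by simp only [Finset.mem_range.1 hi, if_true]
  have htot : ∑ j, ((Finset.range N).filter fun i => π i = j).card = N :=
    (Finset.card_eq_sum_card_fiberwise fun i _ =>
      Finset.mem_coe.2 (Finset.mem_univ (π i))).symm.trans (Finset.card_range N)
  have hfloor : ⌊((N + 1 : ℕ) : ℚ) / 3⌋₊ = (N + 1) / 3 := by
    exact_mod_cast Nat.floor_div_eq_div (K := ℚ) (N + 1) 3
  have hceil : ⌈((N + 1 : ℕ) : ℚ) / 3⌉₊ = (N + 3) / 3 := by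
    rw [Nat.ceil_eq_iff (by omega)]
    have h1 := Nat.div_add_mod (N + 3) 3
    have h2 := Nat.mod_lt (N + 3) (show 0 < 3 by norm_num)
    have h3 : 1 ≤ (N + 3) / 3 := by omega
    constructor
    · rw [lt_div_iff₀ (by norm_num)]
      have : ((N + 3) / 3 - 1) * 3 < N + 1 := by omega
      exact_mod_cast this
    · rw [div_le_iff₀ (by norm_num)]
      have : N + 1 ≤ ((N + 3) / 3) * 3 := by omega
      exact_mod_cast this
  intro j
  rw [hcount, hfloor, hceil]
  rw [Fin.sum_univ_three] at htot
  have p0 := hπ 0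
  have p1 := hπ 1
  have p2 := hπ 2
  rcases fin_three_cases jstar with rfl | rfl | rfl <;>
    rcases fin_three_cases j with rfl | rfl | rfl <;>
    simp at p0 p1 p2 ⊢ <;> omega

/-! ### Reasoning about programs -/

/-- Started with register contents `s`, the program halts after at most `T` steps with contents
satisfying `Q`. -/
def Runs (ask : ℝ → LayeredPiece 2 → ℝ) (P : Prog) (s : ℕ → ℝ) (T : ℕ) (Q : (ℕ → ℝ) → Prop) :
    Prop :=
  ∃ s' t, Exec ask P s s' t ∧ t ≤ T ∧ Q s'

/-- All registers that the program may change have a number at least `b`. -/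
def Prog.WritesAbove (b : ℕ) : Prog → Prop
  | .const d _ => b ≤ d
  | .copy d _ => b ≤ d
  | .arith _ d _ _ => b ≤ d
  | .query d _ _ _ _ _ => b ≤ d
  | .seq p p' => p.WritesAbove b ∧ p'.WritesAbove b
  | .ifLt _ _ p p' => p.WritesAbove b ∧ p'.WritesAbove b
  | .whileLt _ _ p => p.WritesAbove b

section Runs

variable {ask : ℝ → LayeredPiece 2 → ℝ} {P P' : Prog} {s : ℕ → ℝ} {T T' : ℕ}
  {Q Q' : (ℕ → ℝ) → Prop}

/-- Registers with numbers below those written by a program keep their contents. -/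
theorem Exec.eq_of_lt {s' : ℕ → ℝ} {t b : ℕ} (h : Exec ask P s s' t) (hP : P.WritesAbove b) :
    ∀ r < b, s' r = s r := by
  induction h with
  | const | copy | arith | query =>
    intro r hr
    exact Function.update_of_ne (hr.trans_le hP).ne _ _
  | seq _ _ ih ih' => exact fun r hr => (ih' hP.2 r hr).trans (ih hP.1 r hr)
  | ifTrue _ _ ih => exact ih hP.1
  | ifFalse _ _ ih => exact ih hP.2
  | whileTrue _ _ _ ih ih' => exact fun r hr => (ih' hP r hr).trans (ih hP r hr)
  | whileFalse _ => exact fun _ _ => rfl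

theorem Runs.mono (h : Runs ask P s T Q) (hT : T ≤ T') (hQ : ∀ s', Q s' → Q' s') :
    Runs ask P s T' Q' := by
  obtain ⟨s', t, he, ht, hq⟩ := h
  exact ⟨s', t, he, ht.trans hT, hQ s' hq⟩

theorem Runs.frame {b : ℕ} (h : Runs ask P s T Q) (hP : P.WritesAbove b) :
    Runs ask P s T (fun s' => (∀ r < b, s' r = s r) ∧ Q s') := by
  obtain ⟨s', t, he, ht, hq⟩ := h
  exact ⟨s', t, he, ht, he.eq_of_lt hP, hq⟩

theorem Runs.seq (h : Runs ask P s T Q) (h' : ∀ s', Q s' → Runs ask P' s' T' Q') :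
    Runs ask (.seq P P') s (T + T') Q' := by
  obtain ⟨s', t, he, ht, hq⟩ := h
  obtain ⟨s'', t', he', ht', hq'⟩ := h' s' hq
  exact ⟨s'', t + t', .seq he he', Nat.add_le_add ht ht', hq'⟩

theorem Runs.seq_eq {s₁ : ℕ → ℝ} (h : Runs ask P s T (· = s₁)) (h' : Runs ask P' s₁ T' Q) :
    Runs ask (.seq P P') s (T + T') Q :=
  h.seq fun _ e => e ▸ h'

theorem Runs.const {d : ℕ} {c : ℤ} (h : Q (Function.update s d (c : ℝ))) :
    Runs ask (.const d c) s (T + 1) Q :=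
  ⟨_, _, .const d c s, Nat.le_add_left _ _, h⟩

theorem Runs.copy {d a : ℕ} (h : Q (Function.update s d (s a))) :
    Runs ask (.copy d a) s (T + 1) Q :=
  ⟨_, _, .copy d a s, Nat.le_add_left _ _, h⟩

theorem Runs.arith {op : ArithOp} {d a b : ℕ}
    (h : Q (Function.update s d (op.eval (s a) (s b)))) :
    Runs ask (.arith op d a b) s (T + 1) Q :=
  ⟨_, _, .arith op d a b s, Nat.le_add_left _ _, h⟩

theorem Runs.const_seq {d : ℕ} {c : ℤ} (h : Runs ask P (Function.update s d (c : ℝ)) T Q) :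
    Runs ask (.seq (.const d c) P) s (T + 1) Q :=
  ((Runs.const (T := 0) rfl : Runs ask (.const d c) s 1 (· = _)).seq_eq h).mono (by omega)
    fun _ h => h

theorem Runs.copy_seq {d a : ℕ} (h : Runs ask P (Function.update s d (s a)) T Q) :
    Runs ask (.seq (.copy d a) P) s (T + 1) Q :=
  ((Runs.copy (T := 0) rfl : Runs ask (.copy d a) s 1 (· = _)).seq_eq h).mono (by omega)
    fun _ h => h

theorem Runs.arith_seq {op : ArithOp} {d a b : ℕ}
    (h : Runs ask P (Function.update s d (op.eval (s a) (s b))) T Q) :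
    Runs ask (.seq (.arith op d a b) P) s (T + 1) Q :=
  ((Runs.arith (T := 0) rfl : Runs ask (.arith op d a b) s 1 (· = _)).seq_eq h).mono (by omega)
    fun _ h => h

theorem Runs.ifLt {a b : ℕ} (h : s a < s b → Runs ask P s T Q)
    (h' : ¬ s a < s b → Runs ask P' s T Q) : Runs ask (.ifLt a b P P') s (T + 1) Q := by
  by_cases hc : s a < s b
  · obtain ⟨s', t, he, ht, hq⟩ := h hc
    exact ⟨s', t + 1, .ifTrue hc he, Nat.add_le_add_right ht 1, hq⟩
  · obtain ⟨s', t, he, ht, hq⟩ := h' hc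
    exact ⟨s', t + 1, .ifFalse hc he, Nat.add_le_add_right ht 1, hq⟩

/-- A loop with invariant `I k`, where `k` bounds the number of remaining rounds. -/
theorem Runs.whileLt {a b : ℕ} (I : ℕ → (ℕ → ℝ) → Prop)
    (hstep : ∀ k s, I k s → s a < s b → ∃ k', k = k' + 1 ∧ Runs ask P s T (I k')) (k : ℕ) :
    ∀ s, I k s →
      Runs ask (.whileLt a b P) s (k * (T + 1) + 1) (fun s' => ¬ s' a < s' b ∧ ∃ k', I k' s') := by
  induction k with
  | zero =>
    intro s hs
    by_cases hc : s a < s b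
    · obtain ⟨k', hk', -⟩ := hstep 0 s hs hc
      omega
    · exact ⟨s, 1, .whileFalse hc, by omega, hc, 0, hs⟩
  | succ k ih =>
    intro s hs
    by_cases hc : s a < s b
    · obtain ⟨k', hk', s', t, he, ht, hI⟩ := hstep _ s hs hc
      obtain rfl : k = k' := by omega
      obtain ⟨s'', t', he', ht', hI'⟩ := ih s' hI
      refine ⟨s'', t + t' + 1, .whileTrue hc he he', ?_, hI'⟩
      rw [Nat.succ_mul]
      omega
    · exact ⟨s, 1, .whileFalse hc, by omega, hc, k + 1, hs⟩

end Runs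

/-! ### Counting votes -/

/-
Use of the registers: constants are in `12, …, 19` (see `Params`); the search for the long knife
uses `20, …, 23`, that for the short knife `30, …, 36`, and the counting of votes `40, …, 48`.
So each subroutine leaves the registers of the calling one unchanged, see `Prog.WritesAbove`.
-/

/-- The instruction without effect. -/
def skip : Prog := .copy 48 48

/-- Query of the piece with `[R a, R b]` in one layer and `[R a', R b']` in the other one; the
layers are exchanged if `sw` is true. -/
def qry (sw : Bool) (d i a b a' b' : ℕ) : Prog :=
  .query d i (cond sw a' a) (cond sw b' b) (cond sw a a') (cond sw b b')

/-- If `R a` and `R b` are both less than `R c` then add `3` to `R d`. -/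
def voteSolo (d c a b : ℕ) : Prog :=
  .ifLt a c (.ifLt b c (.arith .add d d 16) skip) skip

/-- If neither `R a` nor `R b` is greater than `R c` then add `3` to `R d`. -/
def voteTop (d c a b : ℕ) : Prog :=
  .ifLt c a skip (.ifLt c b skip (.arith .add d d 16))

/-- The votes of agent `R 41` on the division with the long knife at `R 23` and the short knife
at `R 33`. -/
def countBody (sw : Bool) : Prog :=
  .seq (qry sw 42 41 13 33 14 13) <|
  .seq (qry sw 43 41 40 14 13 23) <|
  .seq (qry sw 44 41 33 40 23 14) <|
  .seq (.arith .mul 48 19 33) <|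
  .seq (.arith .add 42 42 48) <|
  .seq (voteSolo 45 42 43 44) <|
  .seq (voteTop 46 43 42 44) <|
  .seq (voteSolo 47 44 42 43) <|
  .arith .add 41 41 14

/-- Three times the numbers of agents for whom part `0` is the only best one, part `1` is a
best one, and part `2` is the only best one are stored in the registers `45`, `46`, `47`. -/
def countVotes (sw : Bool) : Prog :=
  .seq (.ifLt 23 33 (.copy 40 33) (.copy 40 23)) <|
  .seq (.const 45 0) <|
  .seq (.const 46 0) <|
  .seq (.const 47 0) <|
  .seq (.const 41 0) <|
  .whileLt 41 12 (countBody sw)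

/-- The registers of the constants: number of agents, small integers, widths at which the two
searches stop, and slope of the bonus. -/
structure Params (s : ℕ → ℝ) (N : ℕ) (δ δx η : ℝ) : Prop where
  agents : s 12 = N
  zero : s 13 = 0
  one : s 14 = 1
  two : s 15 = 2
  three : s 16 = 3
  short : s 17 = δ
  long : s 18 = δx
  slope : s 19 = η

/-- Asked about pieces with layers exchanged according to `sw`, agent `i` answers with `w i`. -/
def Answers (ask : ℝ → LayeredPiece 2 → ℝ) (sw : Bool) (w : ℕ → LayeredPiece 2 → ℝ) : Prop :=
  ∀ (i : ℕ) (a b c d : ℝ), ask i (intervalPiece (cond sw c a) (cond sw d b) (cond sw a c)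
    (cond sw b d)) = w i (intervalPiece a b c d)

section Programs

variable {ask : ℝ → LayeredPiece 2 → ℝ} {sw : Bool} {w : ℕ → LayeredPiece 2 → ℝ} {P : Prog}
  {s : ℕ → ℝ} {T N : ℕ} {Q : (ℕ → ℝ) → Prop} {δ δx η : ℝ}

theorem Params.of_eq {s' : ℕ → ℝ} (h : Params s N δ δx η) {b : ℕ} (hb : 20 ≤ b)
    (he : ∀ r < b, s' r = s r) : Params s' N δ δx η := by
  constructor <;> rw [he _ (by omega)]
  exacts [h.agents, h.zero, h.one, h.two, h.three, h.short, h.long, h.slope]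

theorem Runs.qry_seq (hw : Answers ask sw w) {d i a b a' b' n : ℕ} (hi : s i = n)
    (h : Runs ask P (Function.update s d (w n (intervalPiece (s a) (s b) (s a') (s b')))) T Q) :
    Runs ask (.seq (qry sw d i a b a' b') P) s (T + 1) Q := by
  have key : Runs ask (qry sw d i a b a' b') s 1
      (· = Function.update s d (w n (intervalPiece (s a) (s b) (s a') (s b')))) := by
    refine ⟨_, _, .query .., le_rfl, ?_⟩
    rw [← hw n, hi]
    cases sw <;> rfl
  exact (key.seq_eq h).mono (by omega) fun _ h => h

theorem runs_skip : Runs ask skip s (T + 1) (· = s) :=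
  Runs.copy (Function.update_eq_self _ _)

open Classical in
theorem Runs.voteSolo_seq {d c a b : ℕ} (h3 : s 16 = 3)
    (h : Runs ask P (Function.update s d (s d + if s a < s c ∧ s b < s c then 3 else 0)) T Q) :
    Runs ask (.seq (voteSolo d c a b) P) s (T + 3) Q := by
  have key : Runs ask (voteSolo d c a b) s 3
      (· = Function.update s d (s d + if s a < s c ∧ s b < s c then 3 else 0)) := by
    refine Runs.ifLt (fun h1 => Runs.ifLt (fun h2 => ?_) (fun h2 => ?_)) (fun h1 => ?_)
    · exact Runs.arith (T := 0) (by simp [h1, h2, h3, ArithOp.eval])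
    · exact runs_skip.mono le_rfl (by simp [h2])
    · exact runs_skip.mono le_rfl (by simp [h1])
  exact (key.seq_eq h).mono (by omega) fun _ h => h

open Classical in
theorem Runs.voteTop_seq {d c a b : ℕ} (h3 : s 16 = 3)
    (h : Runs ask P (Function.update s d (s d + if s a ≤ s c ∧ s b ≤ s c then 3 else 0)) T Q) :
    Runs ask (.seq (voteTop d c a b) P) s (T + 3) Q := by
  have key : Runs ask (voteTop d c a b) s 3
      (· = Function.update s d (s d + if s a ≤ s c ∧ s b ≤ s c then 3 else 0)) := by
    refine Runs.ifLt (fun h1 => ?_) (fun h1 => Runs.ifLt (fun h2 => ?_) (fun h2 => ?_))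
    · exact runs_skip.mono le_rfl (by simp [h1.not_ge])
    · exact runs_skip.mono le_rfl (by simp [h2.not_ge])
    · exact Runs.arith (T := 0) (by simp [not_lt.1 h1, not_lt.1 h2, h3, ArithOp.eval])
  exact (key.seq_eq h).mono (by omega) fun _ h => h

open Classical in
theorem soloCount_succ (i : ℕ) (j : Fin 3) (x y : ℝ) :
    (3 * soloCount w (i + 1) η j x y : ℝ) = 3 * soloCount w i η j x y +
      if ∀ k, k ≠ j → util w η x y i k < util w η x y i j then 3 else 0 := by
  unfold soloCount
  rw [Finset.range_add_one, Finset.filter_insert]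
  split_ifs with h
  · rw [Finset.card_insert_of_notMem (by simp)]; push_cast; ring
  · simp

open Classical in
theorem topCount_succ (i : ℕ) (j : Fin 3) (x y : ℝ) :
    (3 * topCount w (i + 1) η j x y : ℝ) = 3 * topCount w i η j x y +
      if ∀ k, util w η x y i k ≤ util w η x y i j then 3 else 0 := by
  unfold topCount
  rw [Finset.range_add_one, Finset.filter_insert]
  split_ifs with h
  · rw [Finset.card_insert_of_notMem (by simp)]; push_cast; ring
  · simp

theorem countBody_runs (hw : Answers ask sw w) (hs : Params s N δ δx η) {i : ℕ}
    (hi : s 41 = i) (hmax : s 40 = max (s 23) (s 33))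
    (h0 : s 45 = 3 * soloCount w i η 0 (s 23) (s 33))
    (h1 : s 46 = 3 * topCount w i η 1 (s 23) (s 33))
    (h2 : s 47 = 3 * soloCount w i η 2 (s 23) (s 33)) :
    Runs ask (countBody sw) s 15 (fun s' => s' 41 = (i + 1 : ℕ) ∧
      s' 45 = 3 * soloCount w (i + 1) η 0 (s 23) (s 33) ∧
      s' 46 = 3 * topCount w (i + 1) η 1 (s 23) (s 33) ∧
      s' 47 = 3 * soloCount w (i + 1) η 2 (s 23) (s 33)) := by
  classical
  unfold countBody
  refine Runs.qry_seq hw hi (Runs.qry_seq hw (n := i) (by simpa using hi)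
    (Runs.qry_seq hw (n := i) (by simpa using hi) (Runs.arith_seq (Runs.arith_seq
    (Runs.voteSolo_seq (by simpa using hs.three) (Runs.voteTop_seq (by simpa using hs.three)
    (Runs.voteSolo_seq (by simpa using hs.three) (Runs.arith (T := 0) ?_))))))))
  simp only [Function.update_apply, Nat.reduceEqDiff, if_true, if_false, ArithOp.eval, hi, hmax,
    h0, h1, h2, hs.zero, hs.one, hs.slope, soloCount_succ, topCount_succ]
  simp [Fin.forall_fin_succ, util, cut_zero, cut_one, cut_two]

theorem countVotes_runs (hw : Answers ask sw w) (hs : Params s N δ δx η) :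
    Runs ask (countVotes sw) s (16 * N + 8) (fun s' => (∀ r < 40, s' r = s r) ∧
      s' 45 = 3 * soloCount w N η 0 (s 23) (s 33) ∧
      s' 46 = 3 * topCount w N η 1 (s 23) (s 33) ∧
      s' 47 = 3 * soloCount w N η 2 (s 23) (s 33)) := by
  refine Runs.frame ?_ (by simp [countVotes, Prog.WritesAbove, countBody, qry, voteSolo, voteTop,
    skip])
  unfold countVotes
  have hif : Runs ask (.ifLt 23 33 (.copy 40 33) (.copy 40 23)) s 2
      (· = Function.update s 40 (max (s 23) (s 33))) := by
    refine Runs.ifLt (fun h => Runs.copy (T := 0) ?_) (fun h => Runs.copy (T := 0) ?_)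
    · rw [max_eq_right h.le]
    · rw [max_eq_left (not_lt.1 h)]
  refine Runs.mono (hif.seq_eq (Runs.const_seq (Runs.const_seq (Runs.const_seq (Runs.const_seq
    ((Runs.whileLt (T := 15) (I := fun k s' => (∀ r < 40, s' r = s r) ∧
      s' 40 = max (s 23) (s 33) ∧ ∃ i : ℕ, i + k = N ∧ s' 41 = i ∧
      s' 45 = 3 * soloCount w i η 0 (s 23) (s 33) ∧
      s' 46 = 3 * topCount w i η 1 (s 23) (s 33) ∧
      s' 47 = 3 * soloCount w i η 2 (s 23) (s 33)) ?_ N _ ?_))))))) (by omega) ?_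
  · rintro k s' ⟨hf, hm, i, hik, hi, h0, h1, h2⟩ hlt
    have hs' := hs.of_eq (by omega) hf
    rw [hi, hs'.agents, Nat.cast_lt] at hlt
    refine ⟨k - 1, by omega, ?_⟩
    have e23 : s 23 = s' 23 := (hf 23 (by omega)).symm
    have e33 : s 33 = s' 33 := (hf 33 (by omega)).symm
    rw [e23, e33] at hm h0 h1 h2 ⊢
    refine ((countBody_runs hw hs' hi hm h0 h1 h2).frame (b := 41) (by simp [Prog.WritesAbove,
      countBody, qry, voteSolo, voteTop, skip])).mono le_rfl ?_
    rintro s'' ⟨hf', hi', h0', h1', h2'⟩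
    exact ⟨fun r hr => (hf' r (by omega)).trans (hf r hr), (hf' 40 (by omega)).trans hm,
      i + 1, by omega, hi', h0', h1', h2'⟩
  · refine ⟨fun r hr => ?_, by simp, 0, by simp, by simp, by simp [soloCount],
      by simp [topCount], by simp [soloCount]⟩
    repeat rw [Function.update_of_ne (by omega)]
  · rintro s' ⟨hlt, k, hf, -, i, hik, hi, h0, h1, h2⟩
    rw [hi, (hs.of_eq (by omega) hf).agents, Nat.cast_lt] at hlt
    obtain rfl : i = N := by omega
    exact ⟨h0, h1, h2⟩

end Programs

/-! ### The two searches -/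

/-- One round of the search for the position of the short knife: the interval
`[R 30, R 31]`, of length `R 32`, is halved. -/
def shortBody (sw : Bool) : Prog :=
  .seq (.arith .div 32 32 15) <|
  .seq (.arith .add 33 30 31) <|
  .seq (.arith .div 33 33 15) <|
  .seq (countVotes sw) <|
  .ifLt 45 12 (.copy 30 33) (.copy 31 33)

/-- Binary search for a crossing `[R 30, R 31]` when the long knife is at `R 23`. -/
def searchShort (sw : Bool) : Prog :=
  .seq (.const 30 0) <|
  .seq (.const 31 1) <|
  .seq (.const 32 1) <|
  .whileLt 17 32 (shortBody sw)

/-- If `R a < R b` and `R c < R d` then set the register `36` to `0`. -/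
def clearIf (a b c d : ℕ) : Prog := .ifLt a b (.ifLt c d (.const 36 0) skip) skip

/-- Test whether the crossing leans to part `1`: the register `36` becomes `1` or `0`. -/
def testLean (sw : Bool) : Prog :=
  .seq (.copy 33 30) <|
  .seq (countVotes sw) <|
  .seq (.copy 34 46) <|
  .seq (.copy 35 47) <|
  .seq (.copy 33 31) <|
  .seq (countVotes sw) <|
  .seq (.const 36 1) <|
  .seq (clearIf 34 12 46 12) (clearIf 12 35 12 47)

/-- Search for a crossing and test of its lean, for the long knife at `R 23`. -/
def searchAndTest (sw : Bool) : Prog := .seq (searchShort sw) (testLean sw)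

/-- One round of the search for the position of the long knife, between `R 20`, where crossings
lean to part `1`, and `R 21`, where they lean to part `2`; the distance `R 22` is halved. -/
def longBody (sw : Bool) : Prog :=
  .seq (.arith .div 22 22 15) <|
  .seq (.arith .add 23 20 21) <|
  .seq (.arith .div 23 23 15) <|
  .seq (searchAndTest sw) <|
  .ifLt 13 36 (.copy 20 23) (.copy 21 23)

/-- Binary search for the position of the long knife. The two ends of the cake lean to different
parts; that end which leans to part `1` is put into `R 20`, so that `R 20 < R 21` may fail. -/
def searchLong (sw : Bool) : Prog :=
  .seq (.const 23 0) <|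
  .seq (searchAndTest sw) <|
  .seq (.ifLt 13 36 (.seq (.const 20 0) (.const 21 1)) (.seq (.const 20 1) (.const 21 0))) <|
  .seq (.const 22 1) <|
  .whileLt 18 22 (longBody sw)

section Programs

variable {ask : ℝ → LayeredPiece 2 → ℝ} {sw : Bool} {w : ℕ → LayeredPiece 2 → ℝ}
  {s : ℕ → ℝ} {N : ℕ} {δ δx η K : ℝ}

/-- One round of the inner search halves the width and keeps the votes for part `0` below `N / 3`
on the left and at least `N / 3` on the right. -/
theorem shortBody_runs (hw : Answers ask sw w) (hs : Params s N δ δx η)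
    (hle : s 30 ≤ s 31) (hd : s 31 - s 30 = s 32)
    (hl : 3 * soloCount w N η 0 (s 23) (s 30) < N)
    (hu : N ≤ 3 * soloCount w N η 0 (s 23) (s 31)) :
    Runs ask (shortBody sw) s (16 * N + 13) (fun s' => s' 32 = s 32 / 2 ∧
      s 30 ≤ s' 30 ∧ s' 30 ≤ s' 31 ∧ s' 31 ≤ s 31 ∧ s' 31 - s' 30 = s' 32 ∧
      3 * soloCount w N η 0 (s 23) (s' 30) < N ∧
      N ≤ 3 * soloCount w N η 0 (s 23) (s' 31)) := by
  unfold shortBody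
  refine (Runs.arith_seq (Runs.arith_seq (Runs.arith_seq (Runs.seq (countVotes_runs hw
    (hs.of_eq le_rfl fun r hr => ?_)) (T' := 2) ?_)))).mono (T := 16 * N + 13) le_rfl
      fun _ h => h
  · repeat rw [Function.update_of_ne (by omega)]
  · rintro s' ⟨hf, h0, -, -⟩
    simp only [Function.update_apply, Nat.reduceEqDiff, if_true, if_false, ArithOp.eval,
      hs.two] at h0
    have e30 : s' 30 = s 30 := hf 30 (by omega)
    have e31 : s' 31 = s 31 := hf 31 (by omega)
    have e32 : s' 32 = s 32 / 2 := by rw [hf 32 (by omega)]; simp [ArithOp.eval, hs.two]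
    have e33 : s' 33 = (s 30 + s 31) / 2 := by
      rw [hf 33 (by omega)]; simp [ArithOp.eval, hs.two]
    have e12 : s' 12 = N := (hf 12 (by omega)).trans hs.agents
    have hc : s' 45 < s' 12 ↔ 3 * soloCount w N η 0 (s 23) ((s 30 + s 31) / 2) < N := by
      rw [h0, e12]; exact_mod_cast Iff.rfl
    refine Runs.ifLt (fun h => Runs.copy (T := 0) ?_) (fun h => Runs.copy (T := 0) ?_) <;>
      rw [hc] at h <;>
      simp only [Function.update_apply, Nat.reduceEqDiff, if_true, if_false, e30, e31, e32, e33]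
    · exact ⟨trivial, by linarith, by linarith, le_rfl, by linarith, h, hu⟩
    · exact ⟨trivial, le_rfl, by linarith, by linarith, by linarith, hl, not_lt.1 h⟩

theorem searchShort_runs (hw : Answers ask sw w) (hs : Params s N δ δx η) {k : ℕ}
    (hk : 1 ≤ δ * 2 ^ k) (hl : 3 * soloCount w N η 0 (s 23) 0 < N)
    (hu : N ≤ 3 * soloCount w N η 0 (s 23) 1) :
    Runs ask (searchShort sw) s (k * (16 * N + 14) + 4) (fun s' => (∀ r < 30, s' r = s r) ∧
      Crossing w N η δ (s 23) (s' 30) (s' 31)) := by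
  refine Runs.frame ?_ (by simp [searchShort, shortBody, countVotes, Prog.WritesAbove, countBody,
    qry, voteSolo, voteTop, skip])
  unfold searchShort
  refine Runs.mono (Runs.const_seq (Runs.const_seq (Runs.const_seq (Runs.whileLt
    (T := 16 * N + 13) (I := fun k s' => (∀ r < 30, s' r = s r) ∧ 0 ≤ s' 30 ∧ s' 30 ≤ s' 31 ∧
      s' 31 ≤ 1 ∧ s' 31 - s' 30 = s' 32 ∧ s' 32 ≤ δ * 2 ^ k ∧
      3 * soloCount w N η 0 (s 23) (s' 30) < N ∧
      N ≤ 3 * soloCount w N η 0 (s 23) (s' 31)) ?_ k _ ?_)))) le_rfl ?_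
  · rintro k s' ⟨hf, h0, hle, h1, hd, hk, hl, hu⟩ hlt
    have hs' := hs.of_eq (by omega) hf
    have e23 : s 23 = s' 23 := (hf 23 (by omega)).symm
    rw [hs'.short] at hlt
    rw [e23] at hl hu ⊢
    obtain _ | k := k
    · rw [pow_zero, mul_one] at hk
      exact absurd hlt hk.not_gt
    refine ⟨k, rfl, ((shortBody_runs hw hs' hle hd hl hu).frame (b := 30) (by simp [shortBody,
      countVotes, Prog.WritesAbove, countBody, qry, voteSolo, voteTop, skip])).mono le_rfl ?_⟩
    rintro s'' ⟨hf', e, a1, a2, a3, a4, a5, a6⟩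
    refine ⟨fun r hr => (hf' r hr).trans (hf r hr), h0.trans a1, a2, a3.trans h1, a4, ?_, a5, a6⟩
    rw [e]
    rw [pow_succ] at hk
    linarith
  · refine ⟨fun r hr => ?_, by simp, by simp, by simp, by simp, by simpa using hk,
      by simpa using hl, by simpa using hu⟩
    repeat rw [Function.update_of_ne (by omega)]
  · rintro s' ⟨hlt, k, hf, h0, hle, h1, hd, -, hl, hu⟩
    rw [(hs.of_eq (by omega) hf).short] at hlt
    exact ⟨h0, hle, h1, by linarith, hl, hu⟩

open Classical in
theorem clearIf_runs (a b c d : ℕ) : Runs ask (clearIf a b c d) s 3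
    (· = if s a < s b ∧ s c < s d then Function.update s 36 0 else s) := by
  refine Runs.ifLt (fun h1 => Runs.ifLt (fun h2 => ?_) (fun h2 => ?_)) (fun h1 => ?_)
  · exact Runs.const (T := 0) (by simp [h1, h2])
  · exact runs_skip.mono le_rfl (by simp [h2])
  · exact runs_skip.mono le_rfl (by simp [h1])

theorem testLean_runs (hw : Answers ask sw w) (hs : Params s N δ δx η) :
    Runs ask (testLean sw) s (32 * N + 27) (fun s' => (∀ r < 32, s' r = s r) ∧
      (0 < s' 36 ↔ Leans w N η 1 2 (s 23) (s 30) (s 31))) := by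
  refine Runs.frame ?_ (by simp [testLean, clearIf, countVotes, Prog.WritesAbove, countBody,
    qry, voteSolo, voteTop, skip])
  unfold testLean
  refine (Runs.copy_seq (Runs.seq (countVotes_runs hw (hs.of_eq (b := 33) (by omega)
    fun r hr => ?_)) (T' := 16 * N + 18) ?_)).mono (by omega) fun _ h => h
  · rw [Function.update_of_ne (by omega)]
  rintro s₁ ⟨hf, -, h1, h2⟩
  have hs₁ : Params s₁ N δ δx η := hs.of_eq (b := 33) (by omega) fun r hr => by
    rw [hf r (by omega), Function.update_of_ne (by omega)]
  have e23 : s₁ 23 = s 23 := hf 23 (by omega)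
  have e31 : s₁ 31 = s 31 := hf 31 (by omega)
  rw [Function.update_self, Function.update_of_ne (by omega)] at h1 h2
  refine (Runs.copy_seq (Runs.copy_seq (Runs.copy_seq (Runs.seq (countVotes_runs hw
    (hs₁.of_eq (b := 33) (by omega) fun r hr => ?_)) (T' := 7) ?_)))).mono (by omega)
      fun _ h => h
  · repeat rw [Function.update_of_ne (by omega)]
  rintro s₂ ⟨hf', -, h1', h2'⟩
  simp only [Function.update_apply, Nat.reduceEqDiff, if_true, if_false, e23, e31] at h1' h2'
  have e12 : s₂ 12 = N := (hf' 12 (by omega)).trans hs₁.agents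
  have e34 : s₂ 34 = 3 * topCount w N η 1 (s 23) (s 30) := by
    rw [← h1]; exact hf' 34 (by omega)
  have e35 : s₂ 35 = 3 * soloCount w N η 2 (s 23) (s 30) := by
    rw [← h2]; exact hf' 35 (by omega)
  have c1 : s₂ 34 < s₂ 12 ↔ 3 * topCount w N η 1 (s 23) (s 30) < N := by
    rw [e34, e12]; exact_mod_cast Iff.rfl
  have c2 : s₂ 46 < s₂ 12 ↔ 3 * topCount w N η 1 (s 23) (s 31) < N := by
    rw [h1', e12]; exact_mod_cast Iff.rfl
  have c3 : s₂ 12 < s₂ 35 ↔ N < 3 * soloCount w N η 2 (s 23) (s 30) := by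
    rw [e35, e12]; exact_mod_cast Iff.rfl
  have c4 : s₂ 12 < s₂ 47 ↔ N < 3 * soloCount w N η 2 (s 23) (s 31) := by
    rw [h2', e12]; exact_mod_cast Iff.rfl
  unfold Leans
  simp only [← not_lt, ← c1, ← c2, ← c3, ← c4]
  refine Runs.const_seq (Runs.mono ((clearIf_runs _ _ _ _).seq_eq (clearIf_runs _ _ _ _))
    (T' := 6) le_rfl ?_)
  rintro s₃ rfl
  by_cases h34 : s₂ 34 < s₂ 12 <;> by_cases h46 : s₂ 46 < s₂ 12 <;>
    by_cases h35 : s₂ 12 < s₂ 35 <;> by_cases h47 : s₂ 12 < s₂ 47 <;>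
    simp [h34, h46, h35, h47]

theorem searchAndTest_runs (hw : Answers ask sw w) (hs : Params s N δ δx η) {k : ℕ}
    (hk : 1 ≤ δ * 2 ^ k) (hl : 3 * soloCount w N η 0 (s 23) 0 < N)
    (hu : N ≤ 3 * soloCount w N η 0 (s 23) 1) :
    Runs ask (searchAndTest sw) s ((k + 2) * (16 * N + 18)) (fun s' => (∀ r < 30, s' r = s r) ∧
      Crossing w N η δ (s 23) (s' 30) (s' 31) ∧
      (0 < s' 36 ↔ Leans w N η 1 2 (s 23) (s' 30) (s' 31))) := by
  refine ((searchShort_runs hw hs hk hl hu).seq (T' := 32 * N + 27) ?_).mono (by nlinarith)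
    fun _ h => h
  rintro s₁ ⟨hf, hc⟩
  refine (testLean_runs hw (hs.of_eq (by omega) hf)).mono le_rfl ?_
  rintro s₂ ⟨hf', h⟩
  rw [hf 23 (by omega), ← hf' 30 (by omega), ← hf' 31 (by omega)] at h
  rw [← hf' 30 (by omega), ← hf' 31 (by omega)] at hc
  exact ⟨fun r hr => (hf' r (by omega)).trans (hf r hr), hc, h⟩

/-- State of the search for the long knife: crossings lean to part `1` at `u` and to part `2`
at `z`, and the last examined position `x` is one of these two. -/
structure Bracket (w : ℕ → LayeredPiece 2 → ℝ) (N : ℕ) (η δ u z x p q : ℝ) : Prop where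
  left : u ∈ Set.Icc (0 : ℝ) 1
  right : z ∈ Set.Icc (0 : ℝ) 1
  lean_left : ∃ a b, Crossing w N η δ u a b ∧ Leans w N η 1 2 u a b
  lean_right : ∃ a b, Crossing w N η δ z a b ∧ Leans w N η 2 1 z a b
  mem : x = u ∨ x = z
  crossing : Crossing w N η δ x p q

theorem longBody_runs (hw : Answers ask sw w) (hs : Params s N δ δx η) {k : ℕ}
    (hk : 1 ≤ δ * 2 ^ k) (hl : ∀ x, 3 * soloCount w N η 0 x 0 < N)
    (hu : ∀ x ∈ Set.Icc (0 : ℝ) 1, N ≤ 3 * soloCount w N η 0 x 1)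
    (hB : Bracket w N η δ (s 20) (s 21) (s 23) (s 30) (s 31))
    (hd : |s 20 - s 21| = s 22) :
    Runs ask (longBody sw) s ((k + 2) * (16 * N + 18) + 5) (fun s' =>
      Bracket w N η δ (s' 20) (s' 21) (s' 23) (s' 30) (s' 31) ∧ |s' 20 - s' 21| = s' 22 ∧
      s' 22 = s 22 / 2) := by
  unfold longBody
  have hm : (s 20 + s 21) / 2 ∈ Set.Icc (0 : ℝ) 1 := by
    have := hB.left; have := hB.right
    simp only [Set.mem_Icc] at *
    constructor <;> linarith
  refine (Runs.arith_seq (Runs.arith_seq (Runs.arith_seq (Runs.seq (searchAndTest_runs hw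
    (hs.of_eq le_rfl fun r hr => ?_) hk (hl _) ?_) (T' := 2) ?_)))).mono (by omega)
      fun _ h => h
  · repeat rw [Function.update_of_ne (by omega)]
  · simpa [ArithOp.eval, hs.two] using hu _ hm
  rintro s' ⟨hf, hc, ht⟩
  have e20 : s' 20 = s 20 := hf 20 (by omega)
  have e21 : s' 21 = s 21 := hf 21 (by omega)
  have e22 : s' 22 = s 22 / 2 := by rw [hf 22 (by omega)]; simp [ArithOp.eval, hs.two]
  have e23 : s' 23 = (s 20 + s 21) / 2 := by
    rw [hf 23 (by omega)]; simp [ArithOp.eval, hs.two]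
  have e13 : s' 13 = 0 := (hf 13 (by omega)).trans hs.zero
  rw [← hf 23 (by omega), e23] at hc ht
  have hd' : |(s 20 - s 21) / 2| = s 22 / 2 := by rw [abs_div, hd, abs_two]
  refine Runs.ifLt (fun h => Runs.copy (T := 0) ?_) (fun h => Runs.copy (T := 0) ?_) <;>
    rw [e13, ht] at h <;>
    simp only [Function.update_apply, Nat.reduceEqDiff, if_true, if_false, e20, e21, e22, e23]
  · refine ⟨⟨hm, hB.right, ⟨_, _, hc, h⟩, hB.lean_right, Or.inl rfl, hc⟩, ?_, trivial⟩
    rw [← hd']; congr 1; ring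
  · refine ⟨⟨hB.left, hm, hB.lean_left, ⟨_, _, hc, hc.leans h⟩, Or.inr rfl, hc⟩, ?_, trivial⟩
    rw [← hd']; congr 1; ring

theorem searchLong_runs (hw : Answers ask sw w) (hs : Params s N δ δx η)
    (hlip : ∀ i, LipschitzValuation K (w i)) {k l : ℕ}
    (hk : 1 ≤ δ * 2 ^ k) (hkl : 1 ≤ δx * 2 ^ l) (hl : ∀ x, 3 * soloCount w N η 0 x 0 < N)
    (hu : ∀ x ∈ Set.Icc (0 : ℝ) 1, N ≤ 3 * soloCount w N η 0 x 1) :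
    Runs ask (searchLong sw) s ((l + 1) * ((k + 2) * (16 * N + 18) + 6)) (fun s' =>
      (∀ r < 20, s' r = s r) ∧ ∃ u z, |u - z| ≤ δx ∧
        Bracket w N η δ u z (s' 23) (s' 30) (s' 31)) := by
  refine Runs.frame ?_ (by simp [searchLong, longBody, searchAndTest, testLean, clearIf,
    searchShort, shortBody, countVotes, Prog.WritesAbove, countBody, qry, voteSolo, voteTop, skip])
  unfold searchLong
  set T := (k + 2) * (16 * N + 18) with hT
  refine (Runs.const_seq (Runs.seq (searchAndTest_runs hw
    (hs.of_eq (b := 23) (by omega) fun r hr => ?_) hk (hl _) ?_)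
      (T' := l * (T + 5 + 1) + 5) ?_)).mono (by rw [← hT]; ring_nf; omega) fun _ h => h
  · rw [Function.update_of_ne (by omega)]
  · simpa using hu 0 (by simp)
  rintro s₁ ⟨hf, hc, ht⟩
  rw [Function.update_self, Int.cast_zero] at hc ht
  have hs₁ : Params s₁ N δ δx η := hs.of_eq le_rfl fun r hr => by
    rw [hf r (by omega), Function.update_of_ne (by omega)]
  have e23 : s₁ 23 = 0 := by rw [hf 23 (by omega)]; simp
  have hp : s₁ 30 ∈ Set.Icc (0 : ℝ) 1 := ⟨hc.nonneg, hc.le.trans hc.le_one⟩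
  have hq : s₁ 31 ∈ Set.Icc (0 : ℝ) 1 := ⟨hc.nonneg.trans hc.le, hc.le_one⟩
  have h01 : (0 : ℝ) ∈ Set.Icc (0 : ℝ) 1 := by simp
  have h11 : (1 : ℝ) ∈ Set.Icc (0 : ℝ) 1 := by simp
  have init : Runs ask (.ifLt 13 36 (.seq (.const 20 0) (.const 21 1))
      (.seq (.const 20 1) (.const 21 0))) s₁ 3 (fun s' => (∀ r < 20, s' r = s₁ r) ∧
        Bracket w N η δ (s' 20) (s' 21) (s' 23) (s' 30) (s' 31) ∧ |s' 20 - s' 21| = 1) := by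
    refine Runs.frame (Runs.ifLt (fun h => Runs.const_seq (Runs.const (T := 0) ?_))
      (fun h => Runs.const_seq (Runs.const (T := 0) ?_))) (by simp [Prog.WritesAbove]) <;>
      rw [hs₁.zero, ht] at h <;>
      simp only [Function.update_apply, Nat.reduceEqDiff, if_true, if_false, e23, Int.cast_zero,
        Int.cast_one]
    · refine ⟨⟨h01, h11, ⟨_, _, hc, h⟩, ⟨_, _, hc.end_swap hlip, ?_⟩, Or.inl rfl, hc⟩, by simp⟩
      simpa using h.end_swap hlip hp hq
    · have h' := hc.leans h
      refine ⟨⟨h11, h01, ⟨_, _, hc.end_swap hlip, ?_⟩, ⟨_, _, hc, h'⟩, Or.inr rfl, hc⟩, by simp⟩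
      simpa using h'.end_swap hlip hp hq
  refine Runs.mono (T := 3 + (l * (T + 5 + 1) + 1 + 1)) (init.seq ?_) (by omega) fun _ h => h
  rintro s₂ ⟨hf₂, hB, hd⟩
  refine Runs.const_seq (Runs.mono (Runs.whileLt (T := T + 5) (I := fun k s' =>
    Params s' N δ δx η ∧ Bracket w N η δ (s' 20) (s' 21) (s' 23) (s' 30) (s' 31) ∧
      |s' 20 - s' 21| = s' 22 ∧ s' 22 ≤ δx * 2 ^ k) ?_ l _ ?_) le_rfl ?_)
  · rintro m s' ⟨hs', hB, hd, hm⟩ hlt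
    rw [hs'.long] at hlt
    obtain _ | m := m
    · rw [pow_zero, mul_one] at hm
      exact absurd hlt hm.not_gt
    refine ⟨m, rfl, ((longBody_runs hw hs' hk hl hu hB hd).frame (b := 20) (by simp [longBody,
      searchAndTest, testLean, clearIf, searchShort, shortBody, countVotes, Prog.WritesAbove,
      countBody, qry, voteSolo, voteTop, skip])).mono le_rfl ?_⟩
    rintro s'' ⟨hf, hB', hd', e⟩
    refine ⟨hs'.of_eq le_rfl hf, hB', hd', ?_⟩
    rw [e]
    rw [pow_succ] at hm
    linarith
  · refine ⟨hs₁.of_eq le_rfl fun r hr => ?_, by simpa using hB, by simpa using hd,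
      by simpa using hkl⟩
    rw [Function.update_of_ne (by omega), hf₂ r hr]
  · rintro s' ⟨hlt, m, hs', hB, hd, -⟩
    rw [hs'.long] at hlt
    exact ⟨_, _, hd.trans_le (not_lt.1 hlt), hB⟩

end Programs

/-! ### The algorithm -/

/-- Write the ends of the intervals of one part to the registers `r, …, r + 3`. -/
def put (sw : Bool) (r a b a' b' : ℕ) : Prog :=
  .seq (.copy r (cond sw a' a)) <|
  .seq (.copy (r + 1) (cond sw b' b)) <|
  .seq (.copy (r + 2) (cond sw a a')) <|
  .copy (r + 3) (cond sw b b')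

/-- Write the division with the long knife at `R 23` and the short knife at `R 30`. -/
def writeDivision (sw : Bool) : Prog :=
  .seq (.ifLt 23 30 (.copy 40 30) (.copy 40 23)) <|
  .seq (put sw 0 13 30 14 13) <|
  .seq (put sw 4 40 14 13 23) <|
  put sw 8 30 40 23 14

/-- Computation of the constants from the input; the widths at which the searches stop are
`δ = ε / (32 * (K + ε))` and `δ ^ 2`, and the slope of the bonus is `ε / 2`. -/
def setup : Prog :=
  .seq (.const 13 0) <|
  .seq (.const 14 1) <|
  .seq (.const 15 2) <|
  .seq (.const 16 3) <|
  .seq (.arith .sub 12 0 14) <|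
  .seq (.arith .add 40 1 2) <|
  .seq (.const 41 32) <|
  .seq (.arith .mul 40 40 41) <|
  .seq (.arith .div 17 2 40) <|
  .seq (.arith .mul 18 17 17) <|
  .seq (.arith .div 19 2 15) <|
  .seq (.const 23 1) <|
  .const 33 1

/-- The two searches and the output, with layers exchanged if `sw` is true. -/
def divide (sw : Bool) : Prog := .seq (searchLong sw) (writeDivision sw)

/-- The short knife cuts layer `0` if sufficiently many agents prefer this layer to the other
one, and layer `1` otherwise. -/
def birthdayProg : Prog :=
  .seq setup <|
  .seq (countVotes false) <|
  .ifLt 45 12 (divide true) (divide false)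

/-- The division `cut x y`, with layers exchanged if `sw` is true. -/
noncomputable def swapCut (sw : Bool) (x y : ℝ) (j : Fin 3) : LayeredPiece 2 :=
  cond sw (swapLayers (cut x y j)) (cut x y j)

section Correctness

variable {ask : ℝ → LayeredPiece 2 → ℝ} {sw : Bool} {w : ℕ → LayeredPiece 2 → ℝ}
  {s : ℕ → ℝ} {N : ℕ} {δ δx η K ε : ℝ}

theorem put_runs {r a b a' b' : ℕ} (hr : r ≤ 8) (ha : 12 ≤ a) (hb : 12 ≤ b) (ha' : 12 ≤ a')
    (hb' : 12 ≤ b') :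
    Runs ask (put sw r a b a' b') s 4 (fun s' => (∀ i, i < r ∨ 12 ≤ i → s' i = s i) ∧
      s' r = s (cond sw a' a) ∧ s' (r + 1) = s (cond sw b' b) ∧
      s' (r + 2) = s (cond sw a a') ∧ s' (r + 3) = s (cond sw b b')) := by
  refine Runs.copy_seq (Runs.copy_seq (Runs.copy_seq (Runs.copy (T := 0) ?_)))
  have h1 : 12 ≤ cond sw b' b := by cases sw <;> assumption
  have h2 : 12 ≤ cond sw a a' := by cases sw <;> assumption
  have h3 : 12 ≤ cond sw b b' := by cases sw <;> assumption
  refine ⟨fun i hi => ?_, ?_, ?_, ?_, ?_⟩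
  · repeat rw [Function.update_of_ne (by omega)]
  · repeat rw [Function.update_of_ne (by omega)]
    rw [Function.update_self]
  · rw [Function.update_of_ne (by omega), Function.update_of_ne (by omega), Function.update_self,
      Function.update_of_ne (by omega)]
  · rw [Function.update_of_ne (by omega), Function.update_self,
      Function.update_of_ne (by omega), Function.update_of_ne (by omega)]
  · rw [Function.update_self, Function.update_of_ne (by omega), Function.update_of_ne (by omega),
      Function.update_of_ne (by omega)]

theorem writeDivision_runs (hs : Params s N δ δx η) (hx : s 23 ∈ Set.Icc (0 : ℝ) 1)
    (hy : s 30 ∈ Set.Icc (0 : ℝ) 1) :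
    Runs ask (writeDivision sw) s 14 (fun s' => Outputs s' (swapCut sw (s 23) (s 30))) := by
  have hif : Runs ask (.ifLt 23 30 (.copy 40 30) (.copy 40 23)) s 2
      (· = Function.update s 40 (max (s 23) (s 30))) := by
    refine Runs.ifLt (fun h => Runs.copy (T := 0) ?_) (fun h => Runs.copy (T := 0) ?_)
    · rw [max_eq_right h.le]
    · rw [max_eq_left (not_lt.1 h)]
  obtain ⟨h00, h01, h10, h11, h20, h21⟩ := cut_layer hx hy
  unfold writeDivision
  refine hif.seq_eq (T' := 12) (Runs.seq (T := 4) (T' := 8) (put_runs (by omega) (by omega)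
    (by omega) (by omega) (by omega)) ?_)
  rintro s₁ ⟨f₁, a0, a1, a2, a3⟩
  refine Runs.seq (T := 4) (T' := 4) (put_runs (by omega) (by omega) (by omega) (by omega)
    (by omega)) ?_
  rintro s₂ ⟨f₂, b0, b1, b2, b3⟩
  refine (put_runs (by omega) (by omega) (by omega) (by omega) (by omega)).mono le_rfl ?_
  rintro s₃ ⟨f₃, c0, c1, c2, c3⟩
  have g₁ : ∀ r, 12 ≤ r → s₁ r = Function.update s 40 (max (s 23) (s 30)) r :=
    fun r hr => f₁ r (Or.inr hr)
  have g₂ : ∀ r, 12 ≤ r → s₂ r = Function.update s 40 (max (s 23) (s 30)) r :=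
    fun r hr => (f₂ r (Or.inr hr)).trans (g₁ r hr)
  have hc : ∀ r r', 12 ≤ r → 12 ≤ r' → 12 ≤ cond sw r r' := fun r r' h h' => by
    cases sw <;> assumption
  rw [g₁ _ (hc _ _ (by omega) (by omega))] at b0 b1 b2 b3
  rw [g₂ _ (hc _ _ (by omega) (by omega))] at c0 c1 c2 c3
  rw [← f₂ _ (Or.inl (by omega)), ← f₃ _ (Or.inl (by omega))] at a0 a1 a2 a3
  rw [← f₃ _ (Or.inl (by omega))] at b0 b1 b2 b3
  clear f₁ f₂ f₃ g₁ g₂ hc hif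
  intro j l
  rcases fin_three_cases j with rfl | rfl | rfl <;> fin_cases l <;> cases sw <;>
    simp [swapCut, swapLayers, *, hs.zero, hs.one]

theorem setup_runs (n : ℕ) (K ε : ℝ) :
    Runs ask setup (input (n + 1) K ε) 13 (fun s' =>
      Params s' n (ε / ((K + ε) * 32)) ((ε / ((K + ε) * 32)) ^ 2) (ε / 2) ∧
        s' 23 = 1 ∧ s' 33 = 1) := by
  unfold setup
  refine Runs.const_seq (Runs.const_seq (Runs.const_seq (Runs.const_seq (Runs.arith_seq
    (Runs.arith_seq (Runs.const_seq (Runs.arith_seq (Runs.arith_seq (Runs.arith_seq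
    (Runs.arith_seq (Runs.const_seq (Runs.const (T := 0) ?_))))))))))))
  refine ⟨⟨?_, ?_, ?_, ?_, ?_, ?_, ?_, ?_⟩, ?_, ?_⟩ <;>
    simp [input, ArithOp.eval, sq]

theorem divide_runs (hw : Answers ask sw w) (hm : ∀ i, MonotoneValuation (w i))
    (hlip : ∀ i, LipschitzValuation K (w i)) (hε : 0 < ε) (hN : 0 < N)
    (hs : Params s N (ε / ((K + ε) * 32)) ((ε / ((K + ε) * 32)) ^ 2) (ε / 2))
    (h1 : N ≤ 3 * soloCount w N (ε / 2) 0 1 1) {m : ℕ} (hm2 : 2 + K / ε ≤ 2 ^ m) :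
    Runs ask (divide sw) s ((2 * m + 11) * ((m + 7) * (16 * N + 18) + 6) + 14) (fun s' =>
      ∃ x ∈ Set.Icc (0 : ℝ) 1, ∃ y ∈ Set.Icc (0 : ℝ) 1, BalancedVotes w N ε x y ∧
        Outputs s' (swapCut sw x y)) := by
  have hK : 0 ≤ K := (hlip 0).nonneg
  have hKε : 0 < K + ε := by linarith
  set δ := ε / ((K + ε) * 32) with hδ
  have hδ0 : 0 < δ := by positivity
  have hδε : (K + ε) * δ = ε / 32 := by rw [hδ]; field_simp
  have hδ1 : δ ≤ 1 / 32 := by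
    rw [hδ, div_le_div_iff₀ (by positivity) (by norm_num)]; linarith
  have hk : 1 ≤ δ * 2 ^ (m + 5) := by
    have e : (2 + K / ε) * ε = 2 * ε + K := by field_simp
    rw [hδ, div_mul_eq_mul_div, le_div_iff₀ (by positivity), pow_add]
    have := mul_le_mul_of_nonneg_right hm2 hε.le
    rw [e] at this
    linarith
  -- twice as many rounds reach the width `δ ^ 2`
  have hkl : 1 ≤ δ ^ 2 * 2 ^ (2 * (m + 5)) := by
    rw [mul_comm 2 (m + 5), pow_mul, ← mul_pow]
    exact one_le_pow₀ hk
  have hKδ : K * δ ≤ ε / 32 := by rw [← hδε]; exact mul_le_mul_of_nonneg_right (by linarith) hδ0.le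
  have hKδ2 : K * δ ^ 2 ≤ ε / 32 * δ := by
    rw [sq, ← mul_assoc]; exact mul_le_mul_of_nonneg_right hKδ hδ0.le
  have hεδ : ε * δ ≤ ε * (1 / 32) := mul_le_mul_of_nonneg_left hδ1 hε.le
  unfold divide
  refine ((searchLong_runs hw hs hlip hk hkl (fun x => ?_) (fun x hx => ?_)).seq
    fun s' h => ?_).mono (T := (2 * (m + 5) + 1) * ((m + 5 + 2) * (16 * N + 18) + 6) + 14)
      (by ring_nf; rfl) fun _ h => h
  · rw [soloCount_zero_at_zero hm hlip]; omega
  · exact h1.trans (Nat.mul_le_mul_left 3 (soloCount_zero_at_one hm hx))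
  obtain ⟨hf, u, z, huz, hB⟩ := h
  obtain ⟨a, b, hu, lu⟩ := hB.lean_left
  obtain ⟨a', b', hz, lz⟩ := hB.lean_right
  have hx : s' 23 ∈ Set.Icc (0 : ℝ) 1 := by
    rcases hB.mem with e | e <;> rw [e]
    exacts [hB.left, hB.right]
  have hxu : |u - s' 23| ≤ δ ^ 2 ∧ |z - s' 23| ≤ δ ^ 2 := by
    rcases hB.mem with e | e <;> rw [e, sub_self, abs_zero]
    exacts [⟨by positivity, by rwa [abs_sub_comm]⟩, ⟨huz, by positivity⟩]
  have hc := hB.crossing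
  have hy : s' 30 ∈ Set.Icc (0 : ℝ) 1 := ⟨hc.nonneg, hc.le.trans hc.le_one⟩
  refine (writeDivision_runs (hs.of_eq le_rfl hf) hx hy).mono le_rfl fun s'' hs'' =>
    ⟨_, hx, _, hy, ?_, hs''⟩
  refine balanced_of_crossings hm hlip (by positivity) hδ0.le (d := δ ^ 2) ?_ ?_ hc hu hz
    hxu.1 hxu.2 lu lz
  · have : 0 ≤ ε * δ := by positivity
    linarith
  · linarith

theorem oracle_natCast {n : ℕ} (v : Fin n → LayeredPiece 2 → ℝ) {i : ℕ} (hi : i < n - 1) :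
    oracle v (i : ℝ) = v ⟨i, by omega⟩ := by
  funext L
  have h : ∃ i' : Fin n, (i' : ℕ) < n - 1 ∧ (i : ℝ) = ((i' : ℕ) : ℝ) :=
    ⟨⟨i, by omega⟩, hi, rfl⟩
  have h2 := h.choose_spec.2
  rw [oracle, dif_pos h]
  congr 1
  exact Fin.ext (Nat.cast_injective h2).symm

theorem oracle_natCast_of_le {n : ℕ} (v : Fin n → LayeredPiece 2 → ℝ) {i : ℕ} (hi : n - 1 ≤ i) :
    oracle v (i : ℝ) = fun _ => 0 := by
  funext L
  rw [oracle, dif_neg]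
  rintro ⟨i', h1, h2⟩
  rw [Nat.cast_injective h2] at hi
  omega

/-- The number of rounds of a binary search is logarithmic. -/
theorem exists_two_pow_ge {a : ℝ} (ha : 2 ≤ a) :
    ∃ m : ℕ, a ≤ 2 ^ m ∧ (m : ℝ) ≤ 3 * Real.log a := by
  have hl := Real.log_two_gt_d9
  have hla : Real.log 2 ≤ Real.log a := Real.log_le_log (by norm_num) ha
  refine ⟨⌈Real.log a / Real.log 2⌉₊, ?_, ?_⟩
  · rw [← Real.rpow_natCast, ← Real.log_le_log_iff (by linarith) (by positivity),
      Real.log_rpow (by norm_num), ← div_le_iff₀ (by linarith)]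
    exact Nat.le_ceil _
  · have h1 := (Nat.ceil_lt_add_one (a := Real.log a / Real.log 2)
      (div_nonneg (by linarith) (by linarith))).le
    have h2 : Real.log a / Real.log 2 ≤ 1.45 * Real.log a := by
      rw [div_le_iff₀ (by linarith)]
      nlinarith
    linarith

theorem steps_le {m n : ℕ} (hn : 1 ≤ n) {L : ℝ} (hL : 0.69 ≤ L) (hm : (m : ℝ) ≤ 3 * L) :
    ((13 + (16 * n + 8 + ((2 * m + 11) * ((m + 7) * (16 * n + 18) + 6) + 14 + 1)) : ℕ) : ℝ) ≤
      10000 * (((n + 1 : ℕ) : ℝ) * L ^ 2) := by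
  have hn' : (1 : ℝ) ≤ n := by exact_mod_cast hn
  push_cast
  have h1 : (2 * m + 11 : ℝ) ≤ 22 * L := by linarith
  have h2 : (m + 7 : ℝ) ≤ 14 * L := by linarith
  have h3 : (16 * n + 18 : ℝ) ≤ 18 * (n + 1) := by linarith
  have hLn : (n + 1 : ℝ) ≤ (n + 1) * (2 * L) := by nlinarith
  have h4 : ((m + 7) * (16 * n + 18) + 6 : ℝ) ≤ 264 * ((n + 1) * L) := by
    have := mul_le_mul h2 h3 (by positivity) (by positivity)
    linarith
  have h5 := mul_le_mul h1 h4 (by positivity) (by positivity)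
  have h6 : (n + 1 : ℝ) ≤ 4 * ((n + 1) * L ^ 2) := by nlinarith
  nlinarith

end Correctness

end LayeredCake

open LayeredCake
theorem theorem3 :
    ∃ (P : Prog) (C : ℝ), ∀ (n : ℕ) (hn : 3 ≤ n) (v : Fin n → LayeredPiece 2 → ℝ) (K ε : ℝ),
      (∀ i, MonotoneValuation (v i)) → (∀ i, LipschitzValuation K (v i)) → 0 < ε →
      ∃ (s : ℕ → ℝ) (t : ℕ) (A : Fin 3 → LayeredPiece 2),
        Exec (oracle v) P (input n K ε) s t ∧
        (t : ℝ) ≤ C * ((n : ℝ) * Real.log (2 + K / ε) ^ 2) ∧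
        Outputs s A ∧
        IsMultiDivision A ∧ IsContiguous A ∧ IsFeasible A ∧ OneShortOneLongKnife A ∧
        ∀ jstar : Fin 3, ∃ π : Fin n → Fin 3,
          π ⟨n - 1, by omega⟩ = jstar ∧
          (∀ i : Fin n, (i : ℕ) < n - 1 → ∀ j : Fin 3, v i (A j) ≤ v i (A (π i)) + ε) ∧
          ∀ j : Fin 3,
            (Finset.univ.filter (fun i => π i = j)).card = ⌊(n : ℚ) / 3⌋₊ ∨
            (Finset.univ.filter (fun i => π i = j)).card = ⌈(n : ℚ) / 3⌉₊ := by
  refine ⟨birthdayProg, 10000, fun n hn v K ε hv hl hε => ?_⟩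
  obtain ⟨N, rfl⟩ : ∃ N, n = N + 1 := ⟨n - 1, by omega⟩
  have hK : 0 ≤ K := (hl 0).nonneg
  have ha : 2 ≤ 2 + K / ε := le_add_of_nonneg_right (by positivity)
  obtain ⟨m, hm1, hm2⟩ := exists_two_pow_ge ha
  have hL : 0.69 ≤ Real.log (2 + K / ε) := by
    have := Real.log_two_gt_d9
    have := Real.log_le_log (by norm_num) ha
    linarith
  -- numbers that do not belong to an agent give the zero valuation, so `w` is defined on `ℕ`
  let w : ℕ → LayeredPiece 2 → ℝ := fun i => oracle v i
  have hwm : ∀ i, MonotoneValuation (w i) := fun i => by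
    simp only [w]
    rcases lt_or_ge i (N + 1 - 1) with h | h
    · rw [oracle_natCast v h]; exact hv _
    · rw [oracle_natCast_of_le v h]; exact fun _ _ _ => le_rfl
  have hwl : ∀ i, LipschitzValuation K (w i) := fun i => by
    simp only [w]
    rcases lt_or_ge i (N + 1 - 1) with h | h
    · rw [oracle_natCast v h]; exact hl _
    · rw [oracle_natCast_of_le v h]
      intro L L'
      simp only [sub_self, abs_zero]
      exact mul_nonneg hK (Finset.sum_nonneg fun _ _ => ENNReal.toReal_nonneg)
  let wsw : ℕ → LayeredPiece 2 → ℝ := fun i L => w i (swapLayers L)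
  have hans : Answers (oracle v) false w := fun i a b c d => rfl
  have hans' : Answers (oracle v) true wsw := fun i a b c d => by
    simp only [wsw, w, swapLayers_intervalPiece, cond_true]
  have run : Runs (oracle v) birthdayProg (input (N + 1) K ε)
      (13 + (16 * N + 8 + ((2 * m + 11) * ((m + 7) * (16 * N + 18) + 6) + 14 + 1)))
      (fun s => ∃ sw, ∃ x ∈ Set.Icc (0 : ℝ) 1, ∃ y ∈ Set.Icc (0 : ℝ) 1,
        BalancedVotes (fun i L => w i (cond sw (swapLayers L) L)) N ε x y ∧
        Outputs s (swapCut sw x y)) := by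
    refine (setup_runs N K ε).seq fun s₁ ⟨h1, h23, h33⟩ => (countVotes_runs hans h1).seq
      fun s₂ ⟨hf, h0, _, _⟩ => ?_
    have h2 := h1.of_eq (by omega) hf
    rw [h23, h33] at h0
    have hc : s₂ 45 < s₂ 12 ↔ 3 * soloCount w N (ε / 2) 0 1 1 < N := by
      rw [h0, h2.agents]; exact_mod_cast Iff.rfl
    refine Runs.ifLt (fun h => ?_) (fun h => ?_) <;> rw [hc] at h
    · exact (divide_runs hans' (fun i => (hwm i).swap) (fun i => (hwl i).swap) hε (by omega) h2
        (soloCount_swap hwm hwl (by positivity) h) hm1).mono le_rfl fun s hs => ⟨true, hs⟩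
    · exact (divide_runs hans hwm hwl hε (by omega) h2 (not_lt.1 h) hm1).mono le_rfl
        fun s hs => ⟨false, hs⟩
  obtain ⟨s, t, he, ht, sw, x, hx, y, hy, hbal, hout⟩ := run
  refine ⟨s, t, swapCut sw x y, he, (Nat.cast_le.2 ht).trans (steps_le (by omega) hL hm2), hout,
    ?_, ?_, ?_, ?_, fun jstar => ?_⟩
  · cases sw
    exacts [isMultiDivision_cut hx hy, (isMultiDivision_cut hx hy).swap]
  · cases sw
    exacts [isContiguous_cut x y, (isContiguous_cut x y).swap]
  · cases sw
    exacts [isFeasible_cut hx hy, (isFeasible_cut hx hy).swap]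
  · cases sw
    exacts [oneShortOneLongKnife_cut hx hy, (oneShortOneLongKnife_cut hx hy).swap]
  · obtain ⟨π, hπ, hcard⟩ := exists_assignment N _ (fun j => (hbal j).1) (fun j => (hbal j).2)
      (fun i => by
        obtain ⟨j, hj⟩ := Finite.exists_max fun j => w i (cond sw (swapLayers (cut x y j))
          (cut x y j))
        exact ⟨j, fun k => (hj k).trans (le_add_of_nonneg_right hε.le)⟩) jstar
    obtain ⟨σ, h1, h2, h3⟩ := exists_birthday_assignment N _ jstar hπ hcard
    refine ⟨σ, h1, fun i hi j => ?_, h3⟩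
    have h4 := h2 i hi j
    simp only [w, oracle_natCast v hi] at h4
    exact h4
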